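/- **Partial 2-precategories.** A partial 2-precategory $\mathcal C$ consists of the following data (all compositions are written in diagrammatic order). * Objects, with an involution $x\mapsto x^{op}$; sets $shom^1(x,y)$ of simple 1-morphisms, with involutions $\varphi\mapsto\varphi^T\in shom^1(y,x)$ and $\varphi\mapsto\varphi^{op}\in shom^1(x^{op},y^{op})$; a partial composition $\varphi\circ\psi\in shom^1(x,z)$, defined for composable pairs $\varphi\in shom^1(x,y)$, $\psi\in shom^1(y,z)$, such that $(\psi^T,\varphi^T)$ is composable whenever $(\varphi,\psi)$ is, and $(\varphi\circ\psi)^T=\psi^T\circ\varphi^T$. Let $\underline{hom}^1(x,y)$ be the set of finite (if $x=y$ possibly empty) sequences $\underline\varphi$ of consecutive simple 1-morphisms from $x$ to $y$, with concatenation $\sharp$ and $\underline\varphi^T$ the reversed sequence of adjoints. * Sets $shom^2(\underline\varphi,\underline\psi)$ of simple 2-morphisms for $\underline\varphi,\underline\psi\in\underline{hom}^1(x,y)$; identification 2-morphisms $I(\varphi,\psi)\in shom^2((\varphi,\psi),\varphi\circ\psi)$ for composable $(\varphi,\psi)$; cyclicity bijections $shom^2(\underline\varphi\sharp\underline\chi,\underline\psi\sharp\underline\rho)\simeq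 shom^2(\underline\psi^T\sharp\underline\varphi,\underline\rho\sharp\underline\chi^T)$, coherent in the sense that the trivial reordering and a full turn of the cyclic boundary sequence act as the identity and that successive reorderings compose; involutions $A\mapsto A^{op}\in shom^2(\underline\varphi^{op},\underline\psi^{op})$ and $A\mapsto A^T\in shom^2(\underline\psi,\underline\varphi)$, the latter compatible with cyclicity. * A partial vertical composition $A\circ_v B\in shom^2(\underline\varphi,\underline\psi)$ of composable pairs $A\in shom^2(\underline\varphi,\underline\chi)$, $B\in shom^2(\underline\chi,\underline\psi)$, such that $(B^T,A^T)$ is composable whenever $(A,B)$ is, and $(A\circ_vB)^T=B^T\circ_vA^T$. Every $I(\varphi,\psi)$ is composable with every $A\in shom^2(\underline\alpha,(\varphi,\psi))$ on its left and every $B\in shom^2(\varphi\circ\psi,\underline\beta)$ on its right. **Diagrams.** For $\underline\varphi,\underline\psi\in\underline{hom}^1(x,y)$ a diagram from $\underline\varphi$ to $\underline\psi$ is a planar, simply connected, polygonal diagram whose vertices are objects, edges are simple 1-morphisms and faces are simple 2-morphisms, that can be swept from $\underline\varphi$ to $\underline\psi$ one face at a time: a finite sequence of faces $A\in shom^2(\underline\alpha,\underline\beta)$,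 each replacing a segment $\underline\alpha$ of the current sequence by $\underline\beta$. The order in which the faces are swept is immaterial; an edge may be read in either direction (as $\varphi$ or $\varphi^T$) and faces may be reordered by cyclicity. Diagrams without faces exist only for $\underline\varphi=\underline\psi$. Diagrams are concatenated vertically (along a common boundary sequence) and horizontally (at a common end vertex). **Diagram axiom.** A composition of $\underline\varphi$ is a sequence obtained by replacing two consecutive composable entries by their composite; a decomposition is the inverse operation. A sequence of compositions and decompositions $\underline\varphi_0,\dots,\underline\varphi_k$, with the positions at which they take place, has an associated diagram from $\underline\varphi_0$ to $\underline\varphi_k$, whose faces are the corresponding $I$ and $I^T$. $\mathcal C$ is a partial 2-category if for every such sequence with $\underline\varphi_k=\underline\varphi_0$ its diagram $\mathcal D$ is an identity: composing any $L\in shom^2(\underline\psi,\underline\varphi_0)$ (after cyclic reordering) successively with all faces of $\mathcal D$ gives $L$, and likewise on the other side for any $L\in shom^2(\underline\varphi_0,\underline\psi)$. **The sets $hom^2$ of representatives.** $hom^2(\underline\varphi,\underline\psi)$ is the set of diagrams from $\underline\varphi$ to $\underline\psi$ modulo the equivalence relation generated, locally inside diagrams, by: merging two faces whose intersection is a sequence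 $\underline\chi$, if after cyclic reordering to $A\in shom^2(\underline\alpha,\underline\chi)$ and $B\in shom^2(\underline\chi,\underline\beta)$ they are composable, into the face $A\circ_vB$; removing a face that is a two-sided identity for $\circ_v$; removing a closed diagram of identification 2-morphisms and adjoints that is an identity in the sense above. **The completion.** An identity for $x$ is an $e\in shom^1(x,x)$ that is composable with all simple 1-morphisms ending or starting at $x$, with $\psi\circ e=\psi$ and $e\circ\psi=\psi$. Let $\mathcal E$ be any set of identities (for instance all of them, or none). Define $\widehat{\mathcal C}=\widehat{\mathcal C}_{\mathcal E}$ as follows. Its objects are those of $\mathcal C$. Its 1-morphisms $hom^1(x,y)$ are the elements of $\underline{hom}^1(x,y)$ modulo the equivalence relation generated by compositions and by deleting entries that lie in $\mathcal E$. Its 2-morphisms $hom^2(c,d)$, for $c,d\in hom^1(x,y)$, are the diagrams between representatives of $c$ and $d$, modulo the smallest congruence for the two concatenations that contains the above relations on the sets $hom^2(\underline\varphi,\underline\psi)$, identifies the faces $I$ and $I^T$ with the diagrams without faces on their source and on their target, and identifies each edge $e\in\mathcal E$ at $x$ with the vertex $x$. **Theorem.** Let $\mathcal C$ be a partial 2-category.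 1. Let $\underline\varphi,\underline\varphi',\underline\psi\in\underline{hom}^1(x,y)$, with $\underline\varphi$ and $\underline\varphi'$ joined by a sequence of compositions and decompositions. There is a bijection $hom^2(\underline\varphi',\underline\psi)\to hom^2(\underline\varphi,\underline\psi)$ that equals $[\mathcal A]\mapsto[\mathcal D\,\sharp_v\,\mathcal A]$ for the diagram $\mathcal D$ of every such sequence from $\underline\varphi$ to $\underline\varphi'$, and whose inverse equals $[\mathcal A]\mapsto[\mathcal D'\,\sharp_v\,\mathcal A]$ for the diagram $\mathcal D'$ of every such sequence from $\underline\varphi'$ to $\underline\varphi$. The analogous statement holds for $hom^2(\underline\psi,\underline\varphi)\to hom^2(\underline\psi,\underline\varphi')$, $[\mathcal A]\mapsto[\mathcal A\,\sharp_v\,\mathcal D]$. 2. If $\mathcal E=\emptyset$, so that 1-morphisms are sequences modulo composition only, the canonical map $hom^2(\underline\varphi,\underline\psi)\to hom^2([\underline\varphi],[\underline\psi])$ is a bijection for all $\underline\varphi,\underline\psi\in\underline{hom}^1(x,y)$. 3. For every $\mathcal E$, $\widehat{\mathcal C}$ is a strict 2-category: the concatenations of sequences and the vertical and horizontal concatenations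 of diagrams pass to the quotients and define its compositions, the identity 1-morphisms are the classes of the empty sequences, and the identity 2-morphism of $[\underline\varphi]$ is the class of the diagram $\underline\varphi$ without faces. -/

import Mathlib

open Quiver CategoryTheory

universe u v w

infixl:70 " ♯ " => Quiver.Path.comp

/-- A partial two-precategory on a class of objects `C`.

The simple 1-morphisms `x ⟶ y` form a quiver and the adjunction `φ ↦ φᵀ` is `Quiver.reverse`.
Representatives of general 1-morphisms are the finite, possibly empty, sequences
`Quiver.Path x y`; concatenation is `♯` and the adjoint of a sequence is `Quiver.Path.reverse`.
All compositions are written in diagrammatic order. -/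
class PartialTwoPrecategory (C : Type u) extends
    Quiver.{v} C, Quiver.HasInvolutiveReverse C where
  /-- opposite objects -/
  op : C → C
  op_op : ∀ x, op (op x) = x
  /-- opposites of simple 1-morphisms -/
  opHom : ∀ {x y : C}, (x ⟶ y) → (op x ⟶ op y)
  opHom_opHom : ∀ {x y : C} (φ : x ⟶ y), opHom (opHom φ) ≍ φ
  /-- composable pairs of simple 1-morphisms -/
  Comp₁ : ∀ {x y z : C}, (x ⟶ y) → (y ⟶ z) → Prop
  /-- the partial horizontal composition -/
  hcomp : ∀ {x y z : C} (φ : x ⟶ y) (ψ : y ⟶ z), Comp₁ φ ψ → (x ⟶ z)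
  comp₁_reverse : ∀ {x y z : C} {φ : x ⟶ y} {ψ : y ⟶ z},
    Comp₁ φ ψ → Comp₁ (reverse ψ) (reverse φ)
  reverse_hcomp : ∀ {x y z : C} (φ : x ⟶ y) (ψ : y ⟶ z) (h : Comp₁ φ ψ),
    reverse (hcomp φ ψ h) = hcomp (reverse ψ) (reverse φ) (comp₁_reverse h)
  /-- simple 2-morphisms between sequences of simple 1-morphisms -/
  Hom₂ : ∀ {x y : C}, Path x y → Path x y → Type w
  /-- identification 2-morphisms -/
  ident : ∀ {x y z : C} (φ : x ⟶ y) (ψ : y ⟶ z) (h : Comp₁ φ ψ),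
    Hom₂ (φ.toPath ♯ ψ.toPath) (hcomp φ ψ h).toPath
  /-- Cyclicity: `Hom₂ (φ ♯ χ) (ψ ♯ ρ) ≃ Hom₂ (ψᵀ ♯ φ) (ρ ♯ χᵀ)`. The four boundary sequences are
  given by variables together with equations, so that no transport along associativity or
  involutivity is needed when the identifications are composed. -/
  cyc : ∀ {x y z t : C} (φ : Path x y) (χ : Path y z) (ψ : Path x t) (ρ : Path t z)
    {p q : Path x z} {r s : Path t y},
    p = φ ♯ χ → q = ψ ♯ ρ → r = ψ.reverse ♯ φ → s = ρ ♯ χ.reverse → (Hom₂ p q ≃ Hom₂ r s)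
  /-- coherence: the trivial reordering -/
  cyc_refl : ∀ {x y : C} (φ ρ : Path x y)
    (h₁ : φ = φ ♯ Path.nil) (h₂ : ρ = Path.nil ♯ ρ) (h₃ : φ = Path.reverse Path.nil ♯ φ)
    (h₄ : ρ = ρ ♯ Path.reverse Path.nil) (A : Hom₂ φ ρ),
    cyc φ Path.nil Path.nil ρ h₁ h₂ h₃ h₄ A = A
  /-- coherence: two successive reorderings compose to the total reordering -/
  cyc_trans : ∀ {x y z' z t' t : C} (φ : Path x y) (χ₁ : Path y z') (χ₂ : Path z' z)
    (ψ₁ : Path x t') (ψ₂ : Path t' t) (ρ : Path t z)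
    {p q : Path x z} {p' q' : Path t' z'} {r s : Path t y}
    (h₁ : p = φ ♯ χ₁ ♯ χ₂) (h₂ : q = ψ₁ ♯ (ψ₂ ♯ ρ))
    (h₃ : p' = ψ₁.reverse ♯ (φ ♯ χ₁)) (h₄ : q' = ψ₂ ♯ ρ ♯ χ₂.reverse)
    (k₁ : p' = ψ₁.reverse ♯ φ ♯ χ₁) (k₂ : q' = ψ₂ ♯ (ρ ♯ χ₂.reverse))
    (k₃ : r = ψ₂.reverse ♯ (ψ₁.reverse ♯ φ)) (k₄ : s = ρ ♯ χ₂.reverse ♯ χ₁.reverse)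
    (l₁ : p = φ ♯ (χ₁ ♯ χ₂)) (l₂ : q = ψ₁ ♯ ψ₂ ♯ ρ)
    (l₃ : r = (ψ₁ ♯ ψ₂).reverse ♯ φ) (l₄ : s = ρ ♯ (χ₁ ♯ χ₂).reverse) (A : Hom₂ p q),
    cyc (ψ₁.reverse ♯ φ) χ₁ ψ₂ (ρ ♯ χ₂.reverse) k₁ k₂ k₃ k₄
      (cyc (φ ♯ χ₁) χ₂ ψ₁ (ψ₂ ♯ ρ) h₁ h₂ h₃ h₄ A) =
        cyc φ (χ₁ ♯ χ₂) (ψ₁ ♯ ψ₂) ρ l₁ l₂ l₃ l₄ A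
  /-- coherence: a full turn of the cyclic sequence is the trivial reordering -/
  cyc_full : ∀ {x y : C} (φ ψ : Path x y)
    (h₁ : φ = Path.nil ♯ φ) (h₂ : ψ = ψ ♯ Path.nil)
    (h₃ : ψ.reverse = ψ.reverse ♯ Path.nil) (h₄ : φ.reverse = Path.nil ♯ φ.reverse)
    (k₁ : ψ.reverse = Path.nil ♯ ψ.reverse) (k₂ : φ.reverse = φ.reverse ♯ Path.nil)
    (k₃ : φ = φ.reverse.reverse ♯ Path.nil) (k₄ : ψ = Path.nil ♯ ψ.reverse.reverse)
    (A : Hom₂ φ ψ),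
    cyc Path.nil ψ.reverse φ.reverse Path.nil k₁ k₂ k₃ k₄
      (cyc Path.nil φ ψ Path.nil h₁ h₂ h₃ h₄ A) = A
  /-- opposites of simple 2-morphisms -/
  op₂ : ∀ {x y : C} {φ ψ : Path x y}, Hom₂ φ ψ →
    Hom₂ ((Prefunctor.mk op opHom).mapPath φ) ((Prefunctor.mk op opHom).mapPath ψ)
  op₂_op₂ : ∀ {x y : C} {φ ψ : Path x y} (A : Hom₂ φ ψ), op₂ (op₂ A) ≍ A
  /-- adjoints of simple 2-morphisms -/
  adj₂ : ∀ {x y : C} {φ ψ : Path x y}, Hom₂ φ ψ → Hom₂ ψ φ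
  adj₂_adj₂ : ∀ {x y : C} {φ ψ : Path x y} (A : Hom₂ φ ψ), adj₂ (adj₂ A) = A
  /-- Adjunction is compatible with cyclicity. The identification
  `Hom₂ (ψ ♯ ρ) (φ ♯ χ) ≃ Hom₂ (ρ ♯ χᵀ) (ψᵀ ♯ φ)` of the right column of the commuting square is
  the inverse of `cyc ρ χᵀ ψᵀ φ`. -/
  adj₂_cyc : ∀ {x y z t : C} (φ : Path x y) (χ : Path y z) (ψ : Path x t) (ρ : Path t z)
    {p q : Path x z} {r s : Path t y}
    (h₁ : p = φ ♯ χ) (h₂ : q = ψ ♯ ρ) (h₃ : r = ψ.reverse ♯ φ) (h₄ : s = ρ ♯ χ.reverse)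
    (k₃ : q = ψ.reverse.reverse ♯ ρ) (k₄ : p = φ ♯ χ.reverse.reverse) (A : Hom₂ p q),
    cyc ρ χ.reverse ψ.reverse φ h₄ h₃ k₃ k₄ (adj₂ (cyc φ χ ψ ρ h₁ h₂ h₃ h₄ A)) = adj₂ A
  /-- composable pairs of simple 2-morphisms -/
  Comp₂ : ∀ {x y : C} {φ χ ψ : Path x y}, Hom₂ φ χ → Hom₂ χ ψ → Prop
  /-- the partial vertical composition -/
  vcomp : ∀ {x y : C} {φ χ ψ : Path x y} (A : Hom₂ φ χ) (B : Hom₂ χ ψ), Comp₂ A B → Hom₂ φ ψ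
  comp₂_adj₂ : ∀ {x y : C} {φ χ ψ : Path x y} {A : Hom₂ φ χ} {B : Hom₂ χ ψ},
    Comp₂ A B → Comp₂ (adj₂ B) (adj₂ A)
  adj₂_vcomp : ∀ {x y : C} {φ χ ψ : Path x y} (A : Hom₂ φ χ) (B : Hom₂ χ ψ) (h : Comp₂ A B),
    adj₂ (vcomp A B h) = vcomp (adj₂ B) (adj₂ A) (comp₂_adj₂ h)
  /-- identification 2-morphisms can be composed on either side with any adjacent 2-morphism -/
  comp₂_ident : ∀ {x y z : C} (φ : x ⟶ y) (ψ : y ⟶ z) (h : Comp₁ φ ψ) {α : Path x z}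
    (A : Hom₂ α (φ.toPath ♯ ψ.toPath)), Comp₂ A (ident φ ψ h)
  ident_comp₂ : ∀ {x y z : C} (φ : x ⟶ y) (ψ : y ⟶ z) (h : Comp₁ φ ψ) {β : Path x z}
    (B : Hom₂ (hcomp φ ψ h).toPath β), Comp₂ (ident φ ψ h) B

namespace PartialTwoPrecategory

section

variable {C : Type u} [PartialTwoPrecategory.{u, v, w} C]

/-! ### Special cases of cyclicity -/

/-- `Hom₂ α (κ ♯ β) ≃ Hom₂ (κᵀ ♯ α) β` -/
def liftL {x t z : C} (α : Path x z) (κ : Path x t) (β : Path t z) :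
    Hom₂ α (κ ♯ β) ≃ Hom₂ (κ.reverse ♯ α) β :=
  cyc α Path.nil κ β rfl rfl rfl rfl

/-- `Hom₂ α (β ♯ κ) ≃ Hom₂ (α ♯ κᵀ) β` -/
def liftR {x y z : C} (α : Path x z) (β : Path x y) (κ : Path y z) :
    Hom₂ α (β ♯ κ) ≃ Hom₂ (α ♯ κ.reverse) β :=
  (cyc α κ.reverse Path.nil β rfl (by simp) (by simp) (by simp)).symm

/-- `Hom₂ (κ ♯ α) β ≃ Hom₂ α (κᵀ ♯ β)` -/
def dropL {x t z : C} {p : Path x z} (κ : Path x t) (α : Path t z) (h : p = κ ♯ α)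
    (β : Path x z) : Hom₂ p β ≃ Hom₂ α (κ.reverse ♯ β) :=
  (cyc α Path.nil κ.reverse β rfl rfl (by simp [h]) rfl).symm

/-- `Hom₂ (α ♯ κ) β ≃ Hom₂ α (β ♯ κᵀ)` -/
def dropR {x y z : C} (α : Path x y) (κ : Path y z) (β : Path x z) :
    Hom₂ (α ♯ κ) β ≃ Hom₂ α (β ♯ κ.reverse) :=
  cyc α κ Path.nil β rfl (by simp) (by simp) rfl

/-- `Hom₂ φ ψ ≃ Hom₂ ψᵀ φᵀ` -/
def halfTurn {x y : C} (φ ψ : Path x y) : Hom₂ φ ψ ≃ Hom₂ ψ.reverse φ.reverse :=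
  cyc Path.nil φ ψ Path.nil (by simp) rfl rfl (by simp)

/-- `Hom₂ ψ (σ ♯ α ♯ τ) ≃ Hom₂ (σᵀ ♯ ψ ♯ τᵀ) α` -/
def isolateTgt {x a b y : C} (ψ : Path x y) {q : Path x y} (σ : Path x a) (α : Path a b)
    (τ : Path b y) (h : q = σ ♯ α ♯ τ) : Hom₂ ψ q ≃ Hom₂ (σ.reverse ♯ ψ ♯ τ.reverse) α :=
  (cyc ψ Path.nil σ (α ♯ τ) rfl (by simp [h]) rfl rfl).trans (liftR (σ.reverse ♯ ψ) α τ)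

/-- `Hom₂ (σ ♯ α ♯ τ) ψ ≃ Hom₂ α (σᵀ ♯ ψ ♯ τᵀ)` -/
def isolateSrc {x a b y : C} {p : Path x y} (σ : Path x a) (α : Path a b) (τ : Path b y)
    (h : p = σ ♯ α ♯ τ) (ψ : Path x y) : Hom₂ p ψ ≃ Hom₂ α (σ.reverse ♯ ψ ♯ τ.reverse) :=
  (cyc (α ♯ τ) Path.nil σ.reverse ψ rfl rfl (by simp [h]) rfl).symm.trans
    (dropR α τ (σ.reverse ♯ ψ))

/-! ### Diagrams -/

/-- One face `A` of a planar diagram, sitting between the sequences `φ = σ ♯ α ♯ τ` (above) and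
`χ = σ ♯ β ♯ τ` (below). -/
structure Slice {x y : C} (φ χ : Path x y) where
  {a b : C}
  σ : Path x a
  {α β : Path a b}
  τ : Path b y
  face : Hom₂ α β
  src : φ = σ ♯ α ♯ τ
  tgt : χ = σ ♯ β ♯ τ

/-- A planar, simply connected, polygonal diagram of simple 2-morphisms from `φ` to `ψ`, described
by sweeping it from `φ` down to `ψ` one face at a time. Diagrams without faces exist only
for `φ = ψ`. Two sweeps of the same planar diagram are related by `Exchange` below. -/
inductive Diagram {x y : C} : Path x y → Path x y → Type (max u v w)
  | nil (φ : Path x y) : Diagram φ φ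
  | cons {φ χ ψ : Path x y} (s : Slice φ χ) (D : Diagram χ ψ) : Diagram φ ψ

namespace Slice

def whiskerLeft {x y z : C} (ρ : Path x y) {φ χ : Path y z} (s : Slice φ χ) :
    Slice (ρ ♯ φ) (ρ ♯ χ) where
  σ := ρ ♯ s.σ
  τ := s.τ
  face := s.face
  src := (congrArg (ρ ♯ ·) s.src).trans (by simp)
  tgt := (congrArg (ρ ♯ ·) s.tgt).trans (by simp)

def whiskerRight {x y z : C} {φ χ : Path x y} (s : Slice φ χ) (ρ : Path y z) :
    Slice (φ ♯ ρ) (χ ♯ ρ) where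
  σ := s.σ
  τ := s.τ ♯ ρ
  face := s.face
  src := (congrArg (· ♯ ρ) s.src).trans (by simp)
  tgt := (congrArg (· ♯ ρ) s.tgt).trans (by simp)

end Slice

namespace Diagram

/-- The diagram with a single face. -/
def single {x y : C} {φ χ : Path x y} (s : Slice φ χ) : Diagram φ χ := cons s (nil χ)

/-- Vertical concatenation. -/
def vconcat {x y : C} {φ χ ψ : Path x y} : Diagram φ χ → Diagram χ ψ → Diagram φ ψ
  | nil _, D => D
  | cons s E, D => cons s (E.vconcat D)

def whiskerLeft {x y z : C} (ρ : Path x y) {φ ψ : Path y z} :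
    Diagram φ ψ → Diagram (ρ ♯ φ) (ρ ♯ ψ)
  | nil _ => nil _
  | cons s D => cons (s.whiskerLeft ρ) (D.whiskerLeft ρ)

def whiskerRight {x y z : C} {φ ψ : Path x y} (D : Diagram φ ψ) (ρ : Path y z) :
    Diagram (φ ♯ ρ) (ψ ♯ ρ) :=
  match D with
  | nil _ => nil _
  | cons s D => cons (s.whiskerRight ρ) (D.whiskerRight ρ)

/-- Horizontal concatenation: the two diagrams are glued at the common vertex `y`. -/
def hconcat {x y z : C} {φ ψ : Path x y} {φ' ψ' : Path y z} (D : Diagram φ ψ)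
    (D' : Diagram φ' ψ') : Diagram (φ ♯ φ') (ψ ♯ ψ') :=
  (D.whiskerRight φ').vconcat (D'.whiskerLeft ψ)

end Diagram

/-! ### Compositions and decompositions of sequences, and the diagram axiom -/

/-- `φ'` is the composition of `φ` at a position where two consecutive entries are composable. -/
structure Composition {x y : C} (φ φ' : Path x y) where
  {a b c : C}
  σ : Path x a
  f : a ⟶ b
  g : b ⟶ c
  τ : Path c y
  comp : Comp₁ f g
  src : φ = σ ♯ (f.toPath ♯ g.toPath) ♯ τ
  tgt : φ' = σ ♯ (hcomp f g comp).toPath ♯ τ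

/-- A sequence of sequences, each one a composition or a decomposition of the preceding one,
together with the positions at which these take place. -/
inductive Zigzag {x y : C} : Path x y → Path x y → Type (max u v)
  | nil (φ : Path x y) : Zigzag φ φ
  | comp {φ χ ψ : Path x y} (c : Composition φ χ) (Z : Zigzag χ ψ) : Zigzag φ ψ
  | decomp {φ χ ψ : Path x y} (c : Composition χ φ) (Z : Zigzag χ ψ) : Zigzag φ ψ

/-- The identification 2-morphism of a composition, as a face. -/
def Composition.slice {x y : C} {φ φ' : Path x y} (c : Composition φ φ') : Slice φ φ' where
  σ := c.σ
  τ := c.τ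
  face := ident c.f c.g c.comp
  src := c.src
  tgt := c.tgt

/-- The adjoint identification 2-morphism of a decomposition, as a face. -/
def Composition.sliceAdj {x y : C} {φ φ' : Path x y} (c : Composition φ φ') : Slice φ' φ where
  σ := c.σ
  τ := c.τ
  face := adj₂ (ident c.f c.g c.comp)
  src := c.tgt
  tgt := c.src

/-- The diagram patched from the identification 2-morphisms and adjoints of a zigzag. -/
def Zigzag.diagram {x y : C} {φ ψ : Path x y} : Zigzag φ ψ → Diagram φ ψ
  | .nil φ => .nil φ
  | .comp c Z => .cons c.slice Z.diagram
  | .decomp c Z => .cons c.sliceAdj Z.diagram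

/-- `L : Hom₂ ψ φ` can, after a cyclic reordering, be composed with the face of `s`, and `L'` is
the result reordered back. -/
def Slice.Post {x y : C} {φ χ ψ : Path x y} (s : Slice φ χ) (L : Hom₂ ψ φ) (L' : Hom₂ ψ χ) :
    Prop :=
  ∃ h : Comp₂ (isolateTgt ψ s.σ s.α s.τ s.src L) s.face,
    isolateTgt ψ s.σ s.β s.τ s.tgt L' = vcomp _ _ h

/-- As `Slice.Post`, with the face of `s` composed in front of `L : Hom₂ χ ψ`. -/
def Slice.Pre {x y : C} {φ χ ψ : Path x y} (s : Slice φ χ) (L : Hom₂ χ ψ) (L' : Hom₂ φ ψ) :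
    Prop :=
  ∃ h : Comp₂ s.face (isolateSrc s.σ s.β s.τ s.tgt ψ L),
    isolateSrc s.σ s.α s.τ s.src ψ L' = vcomp _ _ h

/-- `L` can be composed successively with all faces of `D`, with result `L'`. -/
def Diagram.Post {x y : C} {φ χ ψ : Path x y} : Diagram φ χ → Hom₂ ψ φ → Hom₂ ψ χ → Prop
  | .nil _, L, L' => L = L'
  | .cons s D, L, L' => ∃ M, s.Post L M ∧ D.Post M L'

/-- All faces of `D` can be composed successively in front of `L`, with result `L'`. -/
def Diagram.Pre {x y : C} {φ χ ψ : Path x y} : Diagram φ χ → Hom₂ χ ψ → Hom₂ φ ψ → Prop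
  | .nil _, L, L' => L = L'
  | .cons s D, L, L' => ∃ M, D.Pre L M ∧ s.Pre M L'

/-- The diagram `D` is an identity for `φ`: `L ∘ D = L` and `D ∘ L = L` for all simple
2-morphisms `L`. -/
def Diagram.IsIdentity {x y : C} {φ : Path x y} (D : Diagram φ φ) : Prop :=
  (∀ (ψ : Path x y) (L : Hom₂ ψ φ), D.Post L L) ∧ ∀ (ψ : Path x y) (L : Hom₂ φ ψ), D.Pre L L

/-- The simple 2-morphism `J` is an identity for the vertical composition. -/
def IsIdentity₂ {x y : C} {φ : Path x y} (J : Hom₂ φ φ) : Prop :=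
  (∀ (ψ : Path x y) (L : Hom₂ ψ φ), ∃ h : Comp₂ L J, vcomp L J h = L) ∧
    ∀ (ψ : Path x y) (L : Hom₂ φ ψ), ∃ h : Comp₂ J L, vcomp J L h = L

/-- The simple 1-morphism `e` is an identity for `x`. -/
def IsIdentity₁ {x : C} (e : x ⟶ x) : Prop :=
  (∀ (y : C) (ψ : x ⟶ y), ∃ h : Comp₁ e ψ, hcomp e ψ h = ψ) ∧
    ∀ (y : C) (ψ : y ⟶ x), ∃ h : Comp₁ ψ e, hcomp ψ e h = ψ

/-! ### The sets of 2-morphisms between representatives -/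

/-- Two sweeps of the same planar diagram which differ in the order in which two faces that follow
each other are met. Either the faces are separated by a sequence `μ`, or they touch at a
vertex, from which a common (possibly empty) boundary part `κ` starts. In the second case the
faces have to be reordered cyclically: the left face, with boundary `α`, `β`, `κ`, is met as
`Hom₂ α (β ♯ κ)` if it comes first and as `Hom₂ (α ♯ κᵀ) β` if it comes last; the right face, with
boundary `κ`, `γ`, `δ`, is met as `Hom₂ (κ ♯ γ) δ` if it comes last and as `Hom₂ γ (κᵀ ♯ δ)` if it
comes first. -/
inductive Exchange {x y : C} {φ χ χ' ψ : Path x y} :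
    Slice φ χ → Slice χ ψ → Slice φ χ' → Slice χ' ψ → Prop
  | far {a b c d : C} (σ : Path x a) {α β : Path a b} (μ : Path b c) {γ δ : Path c d}
      (τ : Path d y) (A : Hom₂ α β) (B : Hom₂ γ δ)
      (h₁ : φ = σ ♯ α ♯ (μ ♯ γ ♯ τ)) (h₂ : χ = σ ♯ β ♯ (μ ♯ γ ♯ τ))
      (h₃ : χ = σ ♯ β ♯ μ ♯ γ ♯ τ) (h₄ : ψ = σ ♯ β ♯ μ ♯ δ ♯ τ)
      (h₅ : φ = σ ♯ α ♯ μ ♯ γ ♯ τ) (h₆ : χ' = σ ♯ α ♯ μ ♯ δ ♯ τ)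
      (h₇ : χ' = σ ♯ α ♯ (μ ♯ δ ♯ τ)) (h₈ : ψ = σ ♯ β ♯ (μ ♯ δ ♯ τ)) :
      Exchange ⟨σ, μ ♯ γ ♯ τ, A, h₁, h₂⟩ ⟨σ ♯ β ♯ μ, τ, B, h₃, h₄⟩
        ⟨σ ♯ α ♯ μ, τ, B, h₅, h₆⟩ ⟨σ, μ ♯ δ ♯ τ, A, h₇, h₈⟩
  | near {a b c d : C} (σ : Path x a) {α : Path a b} {β : Path a c} (κ : Path c b)
      {γ : Path b d} {δ : Path c d} (τ : Path d y) (A : Hom₂ α (β ♯ κ)) (B : Hom₂ (κ ♯ γ) δ)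
      (h₁ : φ = σ ♯ α ♯ (γ ♯ τ)) (h₂ : χ = σ ♯ (β ♯ κ) ♯ (γ ♯ τ))
      (h₃ : χ = σ ♯ β ♯ (κ ♯ γ) ♯ τ) (h₄ : ψ = σ ♯ β ♯ δ ♯ τ)
      (h₅ : φ = σ ♯ α ♯ γ ♯ τ) (h₆ : χ' = σ ♯ α ♯ (κ.reverse ♯ δ) ♯ τ)
      (h₇ : χ' = σ ♯ (α ♯ κ.reverse) ♯ (δ ♯ τ)) (h₈ : ψ = σ ♯ β ♯ (δ ♯ τ)) :
      Exchange ⟨σ, γ ♯ τ, A, h₁, h₂⟩ ⟨σ ♯ β, τ, B, h₃, h₄⟩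
        ⟨σ ♯ α, τ, dropL κ γ rfl δ B, h₅, h₆⟩ ⟨σ, δ ♯ τ, liftR α β κ A, h₇, h₈⟩

/-- `D` is the simple 2-morphism obtained by composing `A` and `B` along their common boundary
`χ`, which may be traversed in either direction. -/
def Glues {x y : C} {α χ β : Path x y} (A : Hom₂ α χ) (B : Hom₂ χ β) (D : Hom₂ α β) : Prop :=
  (∃ h : Comp₂ A B, D = vcomp A B h) ∨
    ∃ h : Comp₂ (halfTurn χ β B) (halfTurn α χ A), halfTurn α β D = vcomp _ _ h

/-- Two faces `A`, `B` that follow each other in a sweep and whose intersection is the sequence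
`χ`, are merged to one face `M`. The four cases are the possible positions of `χ` in the lower
boundary of the first and the upper boundary of the second face. In each case the three faces are
first reordered cyclically so that `χ` is the whole target of `A` and the whole source of `B`. -/
inductive Merge {x y : C} {φ φ' ψ : Path x y} : Slice φ φ' → Slice φ' ψ → Slice φ ψ → Prop
  | right {p q r s : C} (σ : Path x p) {α : Path p r} {β : Path p q} {χ : Path q r}
      {γ : Path r s} {δ : Path q s} (τ : Path s y)
      (A : Hom₂ α (β ♯ χ)) (B : Hom₂ (χ ♯ γ) δ) (M : Hom₂ (α ♯ γ) (β ♯ δ))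
      (hM : Glues (liftL α β χ A) (dropR χ γ δ B) (cyc α γ β δ rfl rfl rfl rfl M))
      (h₁ : φ = σ ♯ α ♯ (γ ♯ τ)) (h₂ : φ' = σ ♯ (β ♯ χ) ♯ (γ ♯ τ))
      (h₃ : φ' = σ ♯ β ♯ (χ ♯ γ) ♯ τ) (h₄ : ψ = σ ♯ β ♯ δ ♯ τ)
      (h₅ : φ = σ ♯ (α ♯ γ) ♯ τ) (h₆ : ψ = σ ♯ (β ♯ δ) ♯ τ) :
      Merge ⟨σ, γ ♯ τ, A, h₁, h₂⟩ ⟨σ ♯ β, τ, B, h₃, h₄⟩ ⟨σ, τ, M, h₅, h₆⟩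
  | left {p q r s : C} (σ : Path x p) {α : Path q s} {β : Path r s} {χ : Path q r}
      {γ : Path p q} {δ : Path p r} (τ : Path s y)
      (A : Hom₂ α (χ ♯ β)) (B : Hom₂ (γ ♯ χ) δ) (M : Hom₂ (γ ♯ α) (δ ♯ β))
      (hM : Glues (liftR α χ β A) (dropL γ χ rfl δ B)
        (dropL γ (α ♯ β.reverse) (Path.comp_assoc _ _ _) δ (liftR (γ ♯ α) δ β M)))
      (h₁ : φ = σ ♯ γ ♯ α ♯ τ) (h₂ : φ' = σ ♯ γ ♯ (χ ♯ β) ♯ τ)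
      (h₃ : φ' = σ ♯ (γ ♯ χ) ♯ (β ♯ τ)) (h₄ : ψ = σ ♯ δ ♯ (β ♯ τ))
      (h₅ : φ = σ ♯ (γ ♯ α) ♯ τ) (h₆ : ψ = σ ♯ (δ ♯ β) ♯ τ) :
      Merge ⟨σ ♯ γ, τ, A, h₁, h₂⟩ ⟨σ, β ♯ τ, B, h₃, h₄⟩ ⟨σ, τ, M, h₅, h₆⟩
  | below {p q r s : C} (σ : Path x p) {α : Path p s} {β : Path p q} {χ δ : Path q r}
      {β' : Path r s} (τ : Path s y)
      (A : Hom₂ α (β ♯ χ ♯ β')) (B : Hom₂ χ δ) (M : Hom₂ α (β ♯ δ ♯ β'))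
      (hM : Glues (isolateTgt α β χ β' rfl A) B (isolateTgt α β δ β' rfl M))
      (h₁ : φ = σ ♯ α ♯ τ) (h₂ : φ' = σ ♯ (β ♯ χ ♯ β') ♯ τ)
      (h₃ : φ' = σ ♯ β ♯ χ ♯ (β' ♯ τ)) (h₄ : ψ = σ ♯ β ♯ δ ♯ (β' ♯ τ))
      (h₅ : φ = σ ♯ α ♯ τ) (h₆ : ψ = σ ♯ (β ♯ δ ♯ β') ♯ τ) :
      Merge ⟨σ, τ, A, h₁, h₂⟩ ⟨σ ♯ β, β' ♯ τ, B, h₃, h₄⟩ ⟨σ, τ, M, h₅, h₆⟩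
  | above {p q r s : C} (σ : Path x p) {α χ : Path q r} {γ : Path p q} {δ : Path p s}
      {γ' : Path r s} (τ : Path s y)
      (A : Hom₂ α χ) (B : Hom₂ (γ ♯ χ ♯ γ') δ) (M : Hom₂ (γ ♯ α ♯ γ') δ)
      (hM : Glues A (isolateSrc γ χ γ' rfl δ B) (isolateSrc γ α γ' rfl δ M))
      (h₁ : φ = σ ♯ γ ♯ α ♯ (γ' ♯ τ)) (h₂ : φ' = σ ♯ γ ♯ χ ♯ (γ' ♯ τ))
      (h₃ : φ' = σ ♯ (γ ♯ χ ♯ γ') ♯ τ) (h₄ : ψ = σ ♯ δ ♯ τ)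
      (h₅ : φ = σ ♯ (γ ♯ α ♯ γ') ♯ τ) (h₆ : ψ = σ ♯ δ ♯ τ) :
      Merge ⟨σ ♯ γ, γ' ♯ τ, A, h₁, h₂⟩ ⟨σ, τ, B, h₃, h₄⟩ ⟨σ, τ, M, h₅, h₆⟩

/-- The local identifications of diagrams. -/
inductive LocalMove {x y : C} : ∀ {φ ψ : Path x y}, Diagram φ ψ → Diagram φ ψ → Prop
  | exchange {φ χ χ' ψ : Path x y} {s : Slice φ χ} {t : Slice χ ψ} {t' : Slice φ χ'}
      {s' : Slice χ' ψ} (h : Exchange s t t' s') :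
      LocalMove (.cons s (.single t)) (.cons t' (.single s'))
  | merge {φ φ' ψ : Path x y} {s : Slice φ φ'} {t : Slice φ' ψ} {m : Slice φ ψ}
      (h : Merge s t m) : LocalMove (.cons s (.single t)) (.single m)
  /-- a face that is an identity for the vertical composition is removed -/
  | identity {a b : C} (σ : Path x a) {α : Path a b} (τ : Path b y) {J : Hom₂ α α}
      (hJ : IsIdentity₂ J) : LocalMove (.single ⟨σ, τ, J, rfl, rfl⟩) (.nil (σ ♯ α ♯ τ))
  /-- a diagram of identification 2-morphisms that is an identity is removed -/
  | zigzag {φ : Path x y} (Z : Zigzag φ φ) (hZ : Z.diagram.IsIdentity) :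
      LocalMove Z.diagram (.nil φ)

/-- A local identification inside a larger diagram. -/
inductive Move {x y : C} {φ ψ : Path x y} : Diagram φ ψ → Diagram φ ψ → Prop
  | mk {χ χ' : Path x y} (P : Diagram φ χ) {D D' : Diagram χ χ'} (Q : Diagram χ' ψ)
      (h : LocalMove D D') :
      Move (P.vconcat (D.vconcat Q)) (P.vconcat (D'.vconcat Q))

/-- The set `hom²(φ, ψ)` for representatives `φ`, `ψ`: diagrams modulo the equivalence relation
generated by the local identifications. -/
def Hom2Rep {x y : C} (φ ψ : Path x y) : Type (max u v w) :=
  Quot (Move (φ := φ) (ψ := ψ))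

def Hom2Rep.mk {x y : C} {φ ψ : Path x y} (D : Diagram φ ψ) : Hom2Rep φ ψ := Quot.mk _ D

end

/-! ### The completion

`E` is a family of simple 1-morphisms, to be thought of as identities, which are identified with
the empty sequences. -/

section

variable {C : Type u} [PartialTwoPrecategory.{u, v, w} C] (E : ∀ x : C, Set (x ⟶ x))

/-- The generating identifications of sequences of simple 1-morphisms. -/
inductive OneStep {x y : C} : Path x y → Path x y → Prop
  | comp {φ φ' : Path x y} (c : Composition φ φ') : OneStep φ φ'
  | unit {a : C} (σ : Path x a) (τ : Path a y) (e : a ⟶ a) (he : e ∈ E a) :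
      OneStep (σ ♯ e.toPath ♯ τ) (σ ♯ τ)

/-- The 1-morphisms of the completion. -/
def Hom1 (x y : C) : Type (max u v) := Quot (OneStep E (x := x) (y := y))

/-- The class of a sequence. -/
def Hom1.mk {x y : C} (φ : Path x y) : Hom1 E x y := Quot.mk _ φ

/-- The identifications of diagrams between possibly different representatives: the smallest
congruence for the two concatenations which contains the identifications of diagrams with fixed
boundary, identifies the identification 2-morphisms and their adjoints with the diagrams without
faces on their source and on their target, and identifies the edges in `E` with vertices. -/
inductive Cong : ∀ {x y : C} {φ ψ φ' ψ' : Path x y}, Diagram φ ψ → Diagram φ' ψ' → Prop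
  | move {x y : C} {φ ψ : Path x y} {D D' : Diagram φ ψ} (h : Move D D') : Cong D D'
  | ident_src {x y : C} {φ φ' : Path x y} (c : Composition φ φ') :
      Cong (.single c.slice) (.nil φ)
  | ident_tgt {x y : C} {φ φ' : Path x y} (c : Composition φ φ') :
      Cong (.single c.slice) (.nil φ')
  | adj_src {x y : C} {φ φ' : Path x y} (c : Composition φ φ') :
      Cong (.single c.sliceAdj) (.nil φ')
  | adj_tgt {x y : C} {φ φ' : Path x y} (c : Composition φ φ') :
      Cong (.single c.sliceAdj) (.nil φ)
  | unit {x : C} (e : x ⟶ x) (he : e ∈ E x) : Cong (.nil e.toPath) (.nil Path.nil)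
  | refl {x y : C} {φ ψ : Path x y} (D : Diagram φ ψ) : Cong D D
  | symm {x y : C} {φ ψ φ' ψ' : Path x y} {D : Diagram φ ψ} {D' : Diagram φ' ψ'} :
      Cong D D' → Cong D' D
  | trans {x y : C} {φ ψ φ' ψ' φ'' ψ'' : Path x y} {D : Diagram φ ψ} {D' : Diagram φ' ψ'}
      {D'' : Diagram φ'' ψ''} : Cong D D' → Cong D' D'' → Cong D D''
  | vconcat {x y : C} {φ χ ψ φ' χ' ψ' : Path x y} {D : Diagram φ χ} {F : Diagram χ ψ}
      {D' : Diagram φ' χ'} {F' : Diagram χ' ψ'} :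
      Cong D D' → Cong F F' → Cong (D.vconcat F) (D'.vconcat F')
  | hconcat {x y z : C} {φ ψ φ' ψ' : Path x y} {α β α' β' : Path y z} {D : Diagram φ ψ}
      {F : Diagram α β} {D' : Diagram φ' ψ'} {F' : Diagram α' β'} :
      Cong D D' → Cong F F' → Cong (D.hconcat F) (D'.hconcat F')

/-- A diagram between representatives of the 1-morphisms `c` and `d`. -/
structure DiagramOver {x y : C} (c d : Hom1 E x y) where
  {φ ψ : Path x y}
  diagram : Diagram φ ψ
  src : Hom1.mk E φ = c
  tgt : Hom1.mk E ψ = d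

/-- The 2-morphisms of the completion. -/
def Hom2 {x y : C} (c d : Hom1 E x y) : Type (max u v w) :=
  Quot fun D D' : DiagramOver E c d => Cong E D.diagram D'.diagram

/-- The class of a diagram. -/
def Hom2.mk {x y : C} {φ ψ : Path x y} (D : Diagram φ ψ) :
    Hom2 E (Hom1.mk E φ) (Hom1.mk E ψ) :=
  Quot.mk _ ⟨D, rfl, rfl⟩

/-- The canonical map from `hom²(φ, ψ)` to `hom²([φ], [ψ])`. -/
def Hom2.ofRep {x y : C} (φ ψ : Path x y) :
    Hom2Rep φ ψ → Hom2 E (Hom1.mk E φ) (Hom1.mk E ψ) :=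
  Quot.lift (fun D => Hom2.mk E D) fun _ _ h => Quot.sound (Cong.move h)

end

/-- The objects of the completion. -/
structure Completion (C : Type u) where
  obj : C

/-- A strict 2-category whose objects are those of `C`, whose 1- and 2-morphisms are `Hom1` and
`Hom2` (up to renaming, by `hom₁` and `hom₂`), whose identities are the classes of the empty
sequences and of the diagrams without faces, and whose compositions are induced by the
concatenations of sequences and diagrams. -/
structure CompletionTwoCategory (C : Type u) [PartialTwoPrecategory.{u, v, w} C]
    (E : ∀ x : C, Set (x ⟶ x)) where
  bicategory : Bicategory.{max u v w, max u v} (Completion C)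
  strict : Bicategory.Strict (Completion C)
  hom₁ : ∀ x y : C, Hom1 E x y ≃ (Completion.mk x ⟶ Completion.mk y)
  hom₂ : ∀ {x y : C} (c d : Hom1 E x y), Hom2 E c d ≃ (hom₁ x y c ⟶ hom₁ x y d)
  hom₁_nil : ∀ x : C, hom₁ x x (Hom1.mk E Path.nil) = 𝟙 (Completion.mk x)
  hom₁_concat : ∀ {x y z : C} (φ : Path x y) (ψ : Path y z),
    hom₁ x z (Hom1.mk E (φ ♯ ψ)) = hom₁ x y (Hom1.mk E φ) ≫ hom₁ y z (Hom1.mk E ψ)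
  hom₂_nil : ∀ {x y : C} (φ : Path x y),
    hom₂ _ _ (Hom2.mk E (Diagram.nil φ)) = 𝟙 (hom₁ x y (Hom1.mk E φ))
  hom₂_vconcat : ∀ {x y : C} {φ χ ψ : Path x y} (D : Diagram φ χ) (F : Diagram χ ψ),
    hom₂ _ _ (Hom2.mk E (D.vconcat F)) =
      hom₂ _ _ (Hom2.mk E D) ≫ hom₂ _ _ (Hom2.mk E F)
  hom₂_hconcat : ∀ {x y z : C} {φ ψ : Path x y} {φ' ψ' : Path y z} (D : Diagram φ ψ)
    (F : Diagram φ' ψ'),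
    hom₂ _ _ (Hom2.mk E (D.hconcat F)) =
      eqToHom (hom₁_concat φ φ') ≫
        (Bicategory.whiskerRight (hom₂ _ _ (Hom2.mk E D)) (hom₁ y z (Hom1.mk E φ')) ≫
          Bicategory.whiskerLeft (hom₁ x y (Hom1.mk E ψ)) (hom₂ _ _ (Hom2.mk E F))) ≫
        eqToHom (hom₁_concat ψ ψ').symm

end PartialTwoPrecategory

/-- A partial 2-category: a partial two-precategory that satisfies the diagram axiom. -/
class PartialTwoCategory (C : Type u) extends PartialTwoPrecategory.{u, v, w} C where
  diagram_axiom : ∀ {x y : C} {φ : Quiver.Path x y} (Z : PartialTwoPrecategory.Zigzag φ φ),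
    Z.diagram.IsIdentity

open PartialTwoPrecategory

/-! By the diagram axiom, the diagram of a closed sequence of compositions and decompositions is
trivial in `Hom2Rep` (`Hom2Rep.zigzag_loop`). Hence parallel zigzags have equal diagrams
(`Hom2Rep.zigzag_unique`), and the diagram of a zigzag is invertible, with the reversed zigzag as
inverse. Concatenation with it is the bijection of the first statement, and it does not depend on
the zigzag.

For the second statement, call two diagrams related if zigzags between their sources and between
their targets complete them to a square that commutes in `Hom2Rep`. This relation is an equivalence
compatible with both concatenations, by uniqueness of zigzags and by interchange, and for empty `E`
it contains the generators of `Cong`, hence all of `Cong` (`ZigzagRel.of_cong`). If the boundaries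
of the two diagrams agree, the zigzags are loops and disappear, which gives injectivity.
Surjectivity is transport along zigzags.

For the third statement, 2-morphisms with a common class as boundary must be made to meet in a
common sequence. Deleting an `e ∈ E` is not a zigzag step, but it becomes one once an edge follows
`e`: compose `e` with that edge. Appending an element of `E` at the end, where there is one, always
provides such an edge, and changes no class. So every 2-morphism has a diagram between prescribed
representatives of this form (`Hom2.exists_rep`). Compositions are defined by these diagrams and may
be computed with any others, since `Cong` is a congruence; each axiom of a 2-category then reduces
to an identity of diagrams (`Hom2.Rep.eq`). -/

namespace PartialTwoPrecategory

/-! ### Concatenation and whiskering of diagrams. -/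

section Whiskering

variable {C : Type u} [PartialTwoPrecategory.{u, v, w} C]

/-- Reassociating boundary sequences changes the type of a diagram, so the whiskering laws are
heterogeneous equalities. They are checked face by face: the face stays the same and only its
surroundings are rebracketed. -/
theorem Slice.mk_heq {x y a b : C} {φ χ φ' χ' : Path x y} {σ σ' : Path x a} {α β : Path a b}
    {τ τ' : Path b y} (A : Hom₂ α β) (h₁ : φ = σ ♯ α ♯ τ) (h₂ : χ = σ ♯ β ♯ τ)
    (h₁' : φ' = σ' ♯ α ♯ τ') (h₂' : χ' = σ' ♯ β ♯ τ') (hσ : σ = σ') (hτ : τ = τ') :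
    Slice.mk σ τ A h₁ h₂ ≍ Slice.mk σ' τ' A h₁' h₂' := by
  subst hσ hτ h₁ h₂ h₁' h₂'
  rfl

namespace Diagram

theorem nil_heq {x y : C} {φ φ' : Path x y} (h : φ = φ') : nil φ ≍ nil φ' := by
  subst h
  rfl

theorem cons_heq {x y : C} {φ χ ψ φ' χ' ψ' : Path x y} {s : Slice φ χ} {D : Diagram χ ψ}
    {s' : Slice φ' χ'} {D' : Diagram χ' ψ'} (hφ : φ = φ') (hχ : χ = χ') (hψ : ψ = ψ')
    (hs : s ≍ s') (hD : D ≍ D') : cons s D ≍ cons s' D' := by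
  subst hφ hχ hψ hs hD
  rfl

@[simp]
theorem vconcat_nil {x y : C} {φ ψ : Path x y} (D : Diagram φ ψ) : D.vconcat (nil ψ) = D := by
  induction D with
  | nil => rfl
  | cons s D ih => exact congrArg (cons s) ih

theorem vconcat_assoc {x y : C} {φ χ ψ ω : Path x y} (D : Diagram φ χ) (F : Diagram χ ψ)
    (G : Diagram ψ ω) : (D.vconcat F).vconcat G = D.vconcat (F.vconcat G) := by
  induction D with
  | nil => rfl
  | cons s D ih => exact congrArg (cons s) (ih F)

theorem whiskerLeft_vconcat {x y z : C} (ρ : Path x y) {φ χ ψ : Path y z} (D : Diagram φ χ)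
    (F : Diagram χ ψ) :
    (D.vconcat F).whiskerLeft ρ = (D.whiskerLeft ρ).vconcat (F.whiskerLeft ρ) := by
  induction D with
  | nil => rfl
  | cons s D ih => exact congrArg (cons _) (ih F)

theorem whiskerRight_vconcat {x y z : C} {φ χ ψ : Path x y} (D : Diagram φ χ)
    (F : Diagram χ ψ) (ρ : Path y z) :
    (D.vconcat F).whiskerRight ρ = (D.whiskerRight ρ).vconcat (F.whiskerRight ρ) := by
  induction D with
  | nil => rfl
  | cons s D ih => exact congrArg (cons _) (ih F)

theorem whiskerLeft_nil_path {x y : C} {φ ψ : Path x y} (D : Diagram φ ψ) :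
    D.whiskerLeft Path.nil ≍ D := by
  induction D with
  | nil φ => exact nil_heq (Path.nil_comp φ)
  | cons s D ih =>
    exact cons_heq (Path.nil_comp _) (Path.nil_comp _) (Path.nil_comp _)
      (Slice.mk_heq s.face _ _ s.src s.tgt (Path.nil_comp _) rfl) ih

/-- A homogeneous equality, unlike the left version: `p ♯ Path.nil` reduces to `p` by definition,
while `Path.nil ♯ p` does not. -/
theorem whiskerRight_nil_path {x y : C} {φ ψ : Path x y} (D : Diagram φ ψ) :
    D.whiskerRight Path.nil = D := by
  induction D with
  | nil φ => rfl
  | cons s D ih => exact congrArg (cons s) ih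

theorem whiskerLeft_whiskerLeft {x y z t : C} (ρ : Path x y) (ρ' : Path y z) {φ ψ : Path z t}
    (D : Diagram φ ψ) : (D.whiskerLeft ρ').whiskerLeft ρ ≍ D.whiskerLeft (ρ ♯ ρ') := by
  have a {p : Path z t} : ρ ♯ (ρ' ♯ p) = ρ ♯ ρ' ♯ p := (Path.comp_assoc _ _ _).symm
  induction D with
  | nil φ => exact nil_heq a
  | cons s D ih =>
    exact cons_heq a a a (Slice.mk_heq s.face _ _ _ _ (Path.comp_assoc _ _ _).symm rfl) ih

theorem whiskerRight_whiskerRight {x y z t : C} {φ ψ : Path x y} (D : Diagram φ ψ)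
    (ρ : Path y z) (ρ' : Path z t) :
    (D.whiskerRight ρ).whiskerRight ρ' ≍ D.whiskerRight (ρ ♯ ρ') := by
  have a {p : Path x y} : p ♯ ρ ♯ ρ' = p ♯ (ρ ♯ ρ') := Path.comp_assoc _ _ _
  induction D with
  | nil φ => exact nil_heq a
  | cons s D ih =>
    exact cons_heq a a a (Slice.mk_heq s.face _ _ _ _ rfl (Path.comp_assoc _ _ _)) ih

theorem whiskerLeft_whiskerRight {x y z t : C} (ρ : Path x y) {φ ψ : Path y z}
    (D : Diagram φ ψ) (ρ' : Path z t) :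
    (D.whiskerLeft ρ).whiskerRight ρ' ≍ (D.whiskerRight ρ').whiskerLeft ρ := by
  have a {p : Path y z} : ρ ♯ p ♯ ρ' = ρ ♯ (p ♯ ρ') := Path.comp_assoc _ _ _
  induction D with
  | nil φ => exact nil_heq a
  | cons s D ih => exact cons_heq a a a (Slice.mk_heq s.face _ _ _ _ rfl rfl) ih

end Diagram

/-! ### Whiskering of local identifications -/

/-- The constructor prescribes the bracketing of the surrounding sequences, which whiskering
destroys. With variables and equations in their place, whiskered slices fit. -/
theorem Exchange.far_of_eq {x y a b c d : C} {φ χ χ' ψ : Path x y} (σ : Path x a)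
    {α β : Path a b} (μ : Path b c) {γ δ : Path c d} (τ : Path d y) (A : Hom₂ α β)
    (B : Hom₂ γ δ) {τ₁ τ₄ : Path b y} {σ₂ σ₃ : Path x c}
    (h₁ : φ = σ ♯ α ♯ τ₁) (h₂ : χ = σ ♯ β ♯ τ₁) (h₃ : χ = σ₂ ♯ γ ♯ τ) (h₄ : ψ = σ₂ ♯ δ ♯ τ)
    (h₅ : φ = σ₃ ♯ γ ♯ τ) (h₆ : χ' = σ₃ ♯ δ ♯ τ) (h₇ : χ' = σ ♯ α ♯ τ₄) (h₈ : ψ = σ ♯ β ♯ τ₄)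
    (hτ₁ : τ₁ = μ ♯ γ ♯ τ) (hσ₂ : σ₂ = σ ♯ β ♯ μ) (hσ₃ : σ₃ = σ ♯ α ♯ μ)
    (hτ₄ : τ₄ = μ ♯ δ ♯ τ) :
    Exchange ⟨σ, τ₁, A, h₁, h₂⟩ ⟨σ₂, τ, B, h₃, h₄⟩ ⟨σ₃, τ, B, h₅, h₆⟩ ⟨σ, τ₄, A, h₇, h₈⟩ := by
  subst hτ₁ hσ₂ hσ₃ hτ₄
  exact .far σ μ τ A B h₁ h₂ h₃ h₄ h₅ h₆ h₇ h₈

theorem Exchange.near_of_eq {x y a b c d : C} {φ χ χ' ψ : Path x y} (σ : Path x a)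
    {α : Path a b} {β : Path a c} (κ : Path c b) {γ : Path b d} {δ : Path c d} (τ : Path d y)
    (A : Hom₂ α (β ♯ κ)) (B : Hom₂ (κ ♯ γ) δ) {τ₁ : Path b y} {τ₄ : Path c y} {σ₂ : Path x c}
    {σ₃ : Path x b}
    (h₁ : φ = σ ♯ α ♯ τ₁) (h₂ : χ = σ ♯ (β ♯ κ) ♯ τ₁) (h₃ : χ = σ₂ ♯ (κ ♯ γ) ♯ τ)
    (h₄ : ψ = σ₂ ♯ δ ♯ τ) (h₅ : φ = σ₃ ♯ γ ♯ τ) (h₆ : χ' = σ₃ ♯ (κ.reverse ♯ δ) ♯ τ)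
    (h₇ : χ' = σ ♯ (α ♯ κ.reverse) ♯ τ₄) (h₈ : ψ = σ ♯ β ♯ τ₄)
    (hτ₁ : τ₁ = γ ♯ τ) (hσ₂ : σ₂ = σ ♯ β) (hσ₃ : σ₃ = σ ♯ α) (hτ₄ : τ₄ = δ ♯ τ) :
    Exchange ⟨σ, τ₁, A, h₁, h₂⟩ ⟨σ₂, τ, B, h₃, h₄⟩ ⟨σ₃, τ, dropL κ γ rfl δ B, h₅, h₆⟩
      ⟨σ, τ₄, liftR α β κ A, h₇, h₈⟩ := by
  subst hτ₁ hσ₂ hσ₃ hτ₄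
  exact .near σ κ τ A B h₁ h₂ h₃ h₄ h₅ h₆ h₇ h₈

theorem Exchange.whiskerLeft {x y z : C} (ρ : Path x y) {φ χ χ' ψ : Path y z} {s : Slice φ χ}
    {t : Slice χ ψ} {t' : Slice φ χ'} {s' : Slice χ' ψ} (h : Exchange s t t' s') :
    Exchange (s.whiskerLeft ρ) (t.whiskerLeft ρ) (t'.whiskerLeft ρ) (s'.whiskerLeft ρ) := by
  cases h with
  | far σ μ τ A B =>
    exact .far_of_eq (ρ ♯ σ) μ τ A B _ _ _ _ _ _ _ _ rfl (by simp) (by simp) rfl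
  | near σ κ τ A B =>
    exact .near_of_eq (ρ ♯ σ) κ τ A B _ _ _ _ _ _ _ _ rfl (by simp) (by simp) rfl

theorem Exchange.whiskerRight {x y z : C} {φ χ χ' ψ : Path x y} {s : Slice φ χ}
    {t : Slice χ ψ} {t' : Slice φ χ'} {s' : Slice χ' ψ} (h : Exchange s t t' s')
    (ρ : Path y z) :
    Exchange (s.whiskerRight ρ) (t.whiskerRight ρ) (t'.whiskerRight ρ) (s'.whiskerRight ρ) := by
  cases h with
  | far σ μ τ A B =>
    exact .far_of_eq σ μ (τ ♯ ρ) A B _ _ _ _ _ _ _ _ (by simp) rfl rfl (by simp)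
  | near σ κ τ A B =>
    exact .near_of_eq σ κ (τ ♯ ρ) A B _ _ _ _ _ _ _ _ (by simp) rfl rfl (by simp)

/-- Only the surroundings of the two faces to be merged are adjusted: those of the merged face are
the bare `σ` and `τ`, whose whiskerings already have the required form. -/
theorem Merge.cast {x y a b c d e f : C} {φ χ ψ : Path x y}
    {σ₁ : Path x a} {α₁ β₁ : Path a b} {τ₁ : Path b y} {A : Hom₂ α₁ β₁}
    {σ₂ : Path x c} {α₂ β₂ : Path c d} {τ₂ : Path d y} {B : Hom₂ α₂ β₂}
    {σ₃ : Path x e} {α₃ β₃ : Path e f} {τ₃ : Path f y} {M : Hom₂ α₃ β₃}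
    {σ₁' : Path x a} {τ₁' : Path b y} {σ₂' : Path x c} {τ₂' : Path d y}
    {h₁ : φ = σ₁ ♯ α₁ ♯ τ₁} {h₂ : χ = σ₁ ♯ β₁ ♯ τ₁} {h₃ : χ = σ₂ ♯ α₂ ♯ τ₂}
    {h₄ : ψ = σ₂ ♯ β₂ ♯ τ₂} {h₅ : φ = σ₃ ♯ α₃ ♯ τ₃} {h₆ : ψ = σ₃ ♯ β₃ ♯ τ₃}
    {h₁' : φ = σ₁' ♯ α₁ ♯ τ₁'} {h₂' : χ = σ₁' ♯ β₁ ♯ τ₁'} {h₃' : χ = σ₂' ♯ α₂ ♯ τ₂'}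
    {h₄' : ψ = σ₂' ♯ β₂ ♯ τ₂'} (hσ₁ : σ₁ = σ₁') (hτ₁ : τ₁ = τ₁') (hσ₂ : σ₂ = σ₂')
    (hτ₂ : τ₂ = τ₂')
    (h : Merge ⟨σ₁, τ₁, A, h₁, h₂⟩ ⟨σ₂, τ₂, B, h₃, h₄⟩ ⟨σ₃, τ₃, M, h₅, h₆⟩) :
    Merge ⟨σ₁', τ₁', A, h₁', h₂'⟩ ⟨σ₂', τ₂', B, h₃', h₄'⟩ ⟨σ₃, τ₃, M, h₅, h₆⟩ := by
  subst hσ₁ hτ₁ hσ₂ hτ₂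
  exact h

theorem Merge.whiskerLeft {x y z : C} (ρ : Path x y) {φ χ ψ : Path y z} {s : Slice φ χ}
    {t : Slice χ ψ} {m : Slice φ ψ} (h : Merge s t m) :
    Merge (s.whiskerLeft ρ) (t.whiskerLeft ρ) (m.whiskerLeft ρ) := by
  cases h with
  | right σ τ A B M hM h₁ h₂ h₃ h₄ h₅ h₆ =>
    exact .cast rfl rfl (by simp) rfl (.right (ρ ♯ σ) τ A B M hM (by simp [h₁]) (by simp [h₂])
      (by simp [h₃]) (by simp [h₄]) (by simp [h₅]) (by simp [h₆]))
  | left σ τ A B M hM h₁ h₂ h₃ h₄ h₅ h₆ =>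
    exact .cast (by simp) rfl rfl rfl (.left (ρ ♯ σ) τ A B M hM (by simp [h₁]) (by simp [h₂])
      (by simp [h₃]) (by simp [h₄]) (by simp [h₅]) (by simp [h₆]))
  | below σ τ A B M hM h₁ h₂ h₃ h₄ h₅ h₆ =>
    exact .cast rfl rfl (by simp) rfl (.below (ρ ♯ σ) τ A B M hM (by simp [h₁]) (by simp [h₂])
      (by simp [h₃]) (by simp [h₄]) (by simp [h₅]) (by simp [h₆]))
  | above σ τ A B M hM h₁ h₂ h₃ h₄ h₅ h₆ =>
    exact .cast (by simp) rfl rfl rfl (.above (ρ ♯ σ) τ A B M hM (by simp [h₁]) (by simp [h₂])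
      (by simp [h₃]) (by simp [h₄]) (by simp [h₅]) (by simp [h₆]))

theorem Merge.whiskerRight {x y z : C} {φ χ ψ : Path x y} {s : Slice φ χ} {t : Slice χ ψ}
    {m : Slice φ ψ} (h : Merge s t m) (ρ : Path y z) :
    Merge (s.whiskerRight ρ) (t.whiskerRight ρ) (m.whiskerRight ρ) := by
  cases h with
  | right σ τ A B M hM h₁ h₂ h₃ h₄ h₅ h₆ =>
    exact .cast rfl (by simp) rfl rfl (.right σ (τ ♯ ρ) A B M hM (by simp [h₁]) (by simp [h₂])
      (by simp [h₃]) (by simp [h₄]) (by simp [h₅]) (by simp [h₆]))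
  | left σ τ A B M hM h₁ h₂ h₃ h₄ h₅ h₆ =>
    exact .cast rfl rfl rfl (by simp) (.left σ (τ ♯ ρ) A B M hM (by simp [h₁]) (by simp [h₂])
      (by simp [h₃]) (by simp [h₄]) (by simp [h₅]) (by simp [h₆]))
  | below σ τ A B M hM h₁ h₂ h₃ h₄ h₅ h₆ =>
    exact .cast rfl rfl rfl (by simp) (.below σ (τ ♯ ρ) A B M hM (by simp [h₁]) (by simp [h₂])
      (by simp [h₃]) (by simp [h₄]) (by simp [h₅]) (by simp [h₆]))
  | above σ τ A B M hM h₁ h₂ h₃ h₄ h₅ h₆ =>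
    exact .cast rfl (by simp) rfl rfl (.above σ (τ ♯ ρ) A B M hM (by simp [h₁]) (by simp [h₂])
      (by simp [h₃]) (by simp [h₄]) (by simp [h₅]) (by simp [h₆]))

theorem LocalMove.identity_of_eq {x y a b : C} {φ : Path x y} (σ : Path x a) {α : Path a b}
    (τ : Path b y) {J : Hom₂ α α} (hJ : IsIdentity₂ J) (h₁ h₂ : φ = σ ♯ α ♯ τ) :
    LocalMove (.single ⟨σ, τ, J, h₁, h₂⟩) (.nil φ) := by
  subst h₁
  exact .identity σ τ hJ

/-! ### Operations on zigzags -/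

def Composition.whiskerLeft {x y z : C} (ρ : Path x y) {φ φ' : Path y z}
    (c : Composition φ φ') : Composition (ρ ♯ φ) (ρ ♯ φ') where
  σ := ρ ♯ c.σ
  f := c.f
  g := c.g
  τ := c.τ
  comp := c.comp
  src := (congrArg (ρ ♯ ·) c.src).trans (by simp only [Path.comp_assoc])
  tgt := (congrArg (ρ ♯ ·) c.tgt).trans (by simp only [Path.comp_assoc])

def Composition.whiskerRight {x y z : C} {φ φ' : Path x y} (c : Composition φ φ')
    (ρ : Path y z) : Composition (φ ♯ ρ) (φ' ♯ ρ) where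
  σ := c.σ
  f := c.f
  g := c.g
  τ := c.τ ♯ ρ
  comp := c.comp
  src := (congrArg (· ♯ ρ) c.src).trans (by simp only [Path.comp_assoc])
  tgt := (congrArg (· ♯ ρ) c.tgt).trans (by simp only [Path.comp_assoc])

namespace Zigzag

def append {x y : C} {φ χ ψ : Path x y} : Zigzag φ χ → Zigzag χ ψ → Zigzag φ ψ
  | nil _, W => W
  | comp c Z, W => comp c (Z.append W)
  | decomp c Z, W => decomp c (Z.append W)

def reverse {x y : C} {φ ψ : Path x y} : Zigzag φ ψ → Zigzag ψ φ
  | nil _ => nil _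
  | comp c Z => Z.reverse.append (decomp c (nil _))
  | decomp c Z => Z.reverse.append (comp c (nil _))

def whiskerLeft {x y z : C} (ρ : Path x y) {φ ψ : Path y z} :
    Zigzag φ ψ → Zigzag (ρ ♯ φ) (ρ ♯ ψ)
  | nil _ => nil _
  | comp c Z => comp (c.whiskerLeft ρ) (Z.whiskerLeft ρ)
  | decomp c Z => decomp (c.whiskerLeft ρ) (Z.whiskerLeft ρ)

def whiskerRight {x y z : C} {φ ψ : Path x y} (Z : Zigzag φ ψ) (ρ : Path y z) :
    Zigzag (φ ♯ ρ) (ψ ♯ ρ) :=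
  match Z with
  | nil _ => nil _
  | comp c Z => comp (c.whiskerRight ρ) (Z.whiskerRight ρ)
  | decomp c Z => decomp (c.whiskerRight ρ) (Z.whiskerRight ρ)

theorem diagram_append {x y : C} {φ χ ψ : Path x y} (Z : Zigzag φ χ) (W : Zigzag χ ψ) :
    (Z.append W).diagram = Z.diagram.vconcat W.diagram := by
  induction Z with
  | nil => rfl
  | comp c Z ih => exact congrArg (Diagram.cons _) (ih W)
  | decomp c Z ih => exact congrArg (Diagram.cons _) (ih W)

/-- A whiskered loop of identifications is thus again the diagram of a loop, so that the diagram
axiom applies to it. -/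
theorem diagram_whiskerLeft {x y z : C} (ρ : Path x y) {φ ψ : Path y z} (Z : Zigzag φ ψ) :
    (Z.whiskerLeft ρ).diagram = Z.diagram.whiskerLeft ρ := by
  induction Z with
  | nil => rfl
  | comp c Z ih => exact congrArg (Diagram.cons _) ih
  | decomp c Z ih => exact congrArg (Diagram.cons _) ih

theorem diagram_whiskerRight {x y z : C} {φ ψ : Path x y} (Z : Zigzag φ ψ) (ρ : Path y z) :
    (Z.whiskerRight ρ).diagram = Z.diagram.whiskerRight ρ := by
  induction Z with
  | nil => rfl
  | comp c Z ih => exact congrArg (Diagram.cons _) ih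
  | decomp c Z ih => exact congrArg (Diagram.cons _) ih

end Zigzag

/-! ### Interchange -/

theorem Move.of_local {x y : C} {φ ψ : Path x y} {D D' : Diagram φ ψ} (h : LocalMove D D') :
    Move D D' := by
  simpa [Diagram.vconcat] using Move.mk (.nil φ) (.nil ψ) h

theorem Move.vconcat_left {x y : C} {φ χ ψ : Path x y} (P : Diagram φ χ) {D D' : Diagram χ ψ}
    (h : Move D D') : Move (P.vconcat D) (P.vconcat D') := by
  obtain ⟨P', Q, h⟩ := h
  simpa only [Diagram.vconcat_assoc] using Move.mk (P.vconcat P') Q h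

theorem Move.vconcat_right {x y : C} {φ χ ψ : Path x y} {D D' : Diagram φ χ}
    (h : Move D D') (Q : Diagram χ ψ) : Move (D.vconcat Q) (D'.vconcat Q) := by
  obtain ⟨P, Q', h⟩ := h
  simpa only [Diagram.vconcat_assoc] using Move.mk P (Q'.vconcat Q) h

namespace Hom2Rep

theorem mk_congr {x y x' y' : C} {φ ψ : Path x y} {φ' ψ' : Path x' y'}
    (f : Diagram φ ψ → Diagram φ' ψ') (hf : ∀ D D', Move D D' → Move (f D) (f D'))
    {D D' : Diagram φ ψ} (h : mk D = mk D') : mk (f D) = mk (f D') :=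
  congrArg (Quot.map f hf) h

theorem vconcat_congr_left {x y : C} {φ χ ψ : Path x y} (P : Diagram φ χ)
    {D D' : Diagram χ ψ} (h : mk D = mk D') : mk (P.vconcat D) = mk (P.vconcat D') :=
  mk_congr _ (fun _ _ => Move.vconcat_left P) h

theorem vconcat_congr_right {x y : C} {φ χ ψ : Path x y} {D D' : Diagram φ χ}
    (h : mk D = mk D') (Q : Diagram χ ψ) : mk (D.vconcat Q) = mk (D'.vconcat Q) :=
  mk_congr (·.vconcat Q) (fun _ _ h => h.vconcat_right Q) h

/-- The faces are separated by what lies to the right of `s` and to the left of `t`, so this is a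
far exchange with `μ = s.τ ♯ t.σ`. -/
theorem slice_interchange {x y z : C} {φ χ : Path x y} {α β : Path y z} (s : Slice φ χ)
    (t : Slice α β) :
    Exchange (s.whiskerRight α) (t.whiskerLeft χ) (t.whiskerLeft φ) (s.whiskerRight β) :=
  .far_of_eq s.σ (s.τ ♯ t.σ) t.τ s.face t.face _ _ _ _ _ _ _ _
    ((congrArg (s.τ ♯ ·) t.src).trans (by simp)) ((congrArg (· ♯ t.σ) s.tgt).trans (by simp))
    ((congrArg (· ♯ t.σ) s.src).trans (by simp)) ((congrArg (s.τ ♯ ·) t.tgt).trans (by simp))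

theorem single_interchange {x y z : C} {φ χ : Path x y} {α β : Path y z} (s : Slice φ χ)
    (F : Diagram α β) :
    mk (.cons (s.whiskerRight α) (F.whiskerLeft χ)) =
      mk ((F.whiskerLeft φ).vconcat (.single (s.whiskerRight β))) := by
  induction F with
  | nil => rfl
  | cons t F ih =>
    -- The face of `s` is moved past the first face of the other diagram, then past the remaining
    -- ones by induction.
    exact (vconcat_congr_right (Quot.sound (Move.of_local (.exchange (slice_interchange s t))))
      (F.whiskerLeft χ)).trans (vconcat_congr_left (.single (t.whiskerLeft φ)) ih)

theorem interchange {x y z : C} {φ χ : Path x y} {α β : Path y z} (D : Diagram φ χ)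
    (F : Diagram α β) :
    mk ((D.whiskerRight α).vconcat (F.whiskerLeft χ)) =
      mk ((F.whiskerLeft φ).vconcat (D.whiskerRight β)) := by
  induction D with
  | nil => simp [Diagram.whiskerRight, Diagram.vconcat]
  | cons s D ih =>
    refine (vconcat_congr_left (.single (s.whiskerRight α)) ih).trans ?_
    refine (vconcat_congr_right (single_interchange s F) (D.whiskerRight β)).trans ?_
    rw [Diagram.vconcat_assoc]
    rfl

end Hom2Rep

end Whiskering

/-! ### Consequences of the diagram axiom -/

section DiagramAxiom

variable {C : Type u} [PartialTwoCategory.{u, v, w} C]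

/-- Being an identity is tested on 2-morphisms with the unwhiskered boundary, so it is not inherited
by the whiskered diagram in an evident way. For zigzags it is obtained afresh, from the diagram
axiom for the whiskered zigzag. -/
theorem LocalMove.whiskerLeft {x y z : C} (ρ : Path x y) {φ ψ : Path y z} {D D' : Diagram φ ψ}
    (h : LocalMove D D') : LocalMove (D.whiskerLeft ρ) (D'.whiskerLeft ρ) := by
  cases h with
  | exchange h => exact .exchange (h.whiskerLeft ρ)
  | merge h => exact .merge (h.whiskerLeft ρ)
  | identity σ τ hJ => exact .identity_of_eq (ρ ♯ σ) τ hJ _ _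
  | zigzag Z =>
    rw [← Z.diagram_whiskerLeft]
    exact .zigzag _ (PartialTwoCategory.diagram_axiom _)

theorem LocalMove.whiskerRight {x y z : C} {φ ψ : Path x y} {D D' : Diagram φ ψ}
    (h : LocalMove D D') (ρ : Path y z) : LocalMove (D.whiskerRight ρ) (D'.whiskerRight ρ) := by
  cases h with
  | exchange h => exact .exchange (h.whiskerRight ρ)
  | merge h => exact .merge (h.whiskerRight ρ)
  | identity σ τ hJ => exact .identity_of_eq σ (τ ♯ ρ) hJ _ _
  | zigzag Z =>
    rw [← Z.diagram_whiskerRight]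
    exact .zigzag _ (PartialTwoCategory.diagram_axiom _)

/-! ### Triviality of loops and uniqueness of zigzag diagrams. -/

namespace Hom2Rep

theorem whiskerLeft_congr {x y z : C} (ρ : Path x y) {φ ψ : Path y z} {D D' : Diagram φ ψ}
    (h : mk D = mk D') : mk (D.whiskerLeft ρ) = mk (D'.whiskerLeft ρ) := by
  refine mk_congr _ (fun D D' h => ?_) h
  obtain ⟨P, Q, h⟩ := h
  simpa only [Diagram.whiskerLeft_vconcat] using Move.mk _ _ (h.whiskerLeft ρ)

theorem whiskerRight_congr {x y z : C} {φ ψ : Path x y} {D D' : Diagram φ ψ}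
    (h : mk D = mk D') (ρ : Path y z) : mk (D.whiskerRight ρ) = mk (D'.whiskerRight ρ) := by
  refine mk_congr (·.whiskerRight ρ) (fun D D' h => ?_) h
  obtain ⟨P, Q, h⟩ := h
  simpa only [Diagram.whiskerRight_vconcat] using Move.mk _ _ (h.whiskerRight ρ)

theorem zigzag_loop {x y : C} {φ : Path x y} (Z : Zigzag φ φ) :
    mk Z.diagram = mk (.nil φ) :=
  Quot.sound (.of_local (.zigzag Z (PartialTwoCategory.diagram_axiom Z)))

theorem zigzag_loop_vconcat {x y : C} {φ χ ψ : Path x y} (Z : Zigzag φ χ) (W : Zigzag χ φ)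
    (A : Diagram φ ψ) : mk (Z.diagram.vconcat (W.diagram.vconcat A)) = mk A := by
  rw [← Diagram.vconcat_assoc, ← Zigzag.diagram_append]
  exact vconcat_congr_right (zigzag_loop _) A

theorem vconcat_zigzag_loop {x y : C} {φ χ ψ : Path x y} (A : Diagram ψ φ) (Z : Zigzag φ χ)
    (W : Zigzag χ φ) : mk ((A.vconcat Z.diagram).vconcat W.diagram) = mk A := by
  rw [Diagram.vconcat_assoc, ← Zigzag.diagram_append]
  exact (vconcat_congr_left A (zigzag_loop _)).trans (by rw [Diagram.vconcat_nil])

/-- Both sides equal the diagram of `Z`, then `W` reversed, then `W`: either the last two or the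
first two form a loop. -/
theorem zigzag_unique {x y : C} {φ ψ : Path x y} (Z W : Zigzag φ ψ) :
    mk Z.diagram = mk W.diagram := by
  rw [← vconcat_zigzag_loop Z.diagram W.reverse W, Diagram.vconcat_assoc]
  exact zigzag_loop_vconcat Z W.reverse W.diagram

/-- Concatenation with the diagram of a zigzag identifies the sets of 2-morphisms out of its
ends. -/
def zigzagEquivSrc {x y : C} {φ φ' : Path x y} (Z : Zigzag φ φ') (ψ : Path x y) :
    Hom2Rep φ' ψ ≃ Hom2Rep φ ψ where
  toFun := Quot.map (Z.diagram.vconcat ·) fun _ _ => Move.vconcat_left _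
  invFun := Quot.map (Z.reverse.diagram.vconcat ·) fun _ _ => Move.vconcat_left _
  left_inv := by
    rintro ⟨A⟩
    exact zigzag_loop_vconcat Z.reverse Z A
  right_inv := by
    rintro ⟨A⟩
    exact zigzag_loop_vconcat Z Z.reverse A

/-- Concatenation with the diagram of a zigzag identifies the sets of 2-morphisms into its
ends. -/
def zigzagEquivTgt {x y : C} {φ φ' : Path x y} (Z : Zigzag φ φ') (ψ : Path x y) :
    Hom2Rep ψ φ ≃ Hom2Rep ψ φ' where
  toFun := Quot.map (·.vconcat Z.diagram) fun _ _ h => h.vconcat_right _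
  invFun := Quot.map (·.vconcat Z.reverse.diagram) fun _ _ h => h.vconcat_right _
  left_inv := by
    rintro ⟨A⟩
    exact vconcat_zigzag_loop A Z Z.reverse
  right_inv := by
    rintro ⟨A⟩
    exact vconcat_zigzag_loop A Z.reverse Z

end Hom2Rep

/-! ### Congruence of diagrams when only compositions are identified. -/

/-- Two diagrams agree up to zigzags between their sources and between their targets. -/
def ZigzagRel {x y : C} {φ ψ φ' ψ' : Path x y} (D : Diagram φ ψ) (D' : Diagram φ' ψ') : Prop :=
  ∃ (Z : Zigzag φ φ') (W : Zigzag ψ ψ'),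
    Hom2Rep.mk (D.vconcat W.diagram) = Hom2Rep.mk (Z.diagram.vconcat D')

namespace ZigzagRel

open Hom2Rep

theorem symm {x y : C} {φ ψ φ' ψ' : Path x y} {D : Diagram φ ψ} {D' : Diagram φ' ψ'}
    (h : ZigzagRel D D') : ZigzagRel D' D := by
  obtain ⟨Z, W, h⟩ := h
  refine ⟨Z.reverse, W.reverse, ?_⟩
  -- A loop is inserted in front of `D'` so that `Z.reverse` can be cancelled on the left and the
  -- given square used.
  rw [← zigzag_loop_vconcat Z.reverse Z (D'.vconcat _)]
  refine vconcat_congr_left _ ?_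
  rw [← Diagram.vconcat_assoc]
  exact (vconcat_congr_right h.symm _).trans (vconcat_zigzag_loop D W W.reverse)

theorem trans {x y : C} {φ ψ φ' ψ' φ'' ψ'' : Path x y} {D : Diagram φ ψ}
    {D' : Diagram φ' ψ'} {D'' : Diagram φ'' ψ''} (h : ZigzagRel D D') (h' : ZigzagRel D' D'') :
    ZigzagRel D D'' := by
  obtain ⟨Z, W, h⟩ := h
  obtain ⟨Z', W', h'⟩ := h'
  refine ⟨Z.append Z', W.append W', ?_⟩
  rw [Zigzag.diagram_append, Zigzag.diagram_append, ← Diagram.vconcat_assoc,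
    vconcat_congr_right h, Diagram.vconcat_assoc, vconcat_congr_left _ h',
    Diagram.vconcat_assoc]

/-- The two squares bring along different zigzags from `χ` to `χ'`; they can be pasted because
`zigzag_unique` identifies these. -/
theorem vconcat {x y : C} {φ χ ψ φ' χ' ψ' : Path x y} {D : Diagram φ χ} {F : Diagram χ ψ}
    {D' : Diagram φ' χ'} {F' : Diagram χ' ψ'} (h : ZigzagRel D D') (h' : ZigzagRel F F') :
    ZigzagRel (D.vconcat F) (D'.vconcat F') := by
  obtain ⟨Z, W, h⟩ := h
  obtain ⟨Z', W', h'⟩ := h'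
  refine ⟨Z, W', ?_⟩
  rw [Diagram.vconcat_assoc, vconcat_congr_left D h', ← Diagram.vconcat_assoc,
    vconcat_congr_right ((vconcat_congr_left D (zigzag_unique Z' W)).trans h),
    Diagram.vconcat_assoc]

/-- Whisker the given square by `ρ`, then slide `Y` past `D'` by interchange. -/
theorem whiskerLeft {x y z : C} {ρ ρ' : Path x y} (Y : Zigzag ρ ρ') {φ ψ φ' ψ' : Path y z}
    {D : Diagram φ ψ} {D' : Diagram φ' ψ'} (h : ZigzagRel D D') :
    ZigzagRel (D.whiskerLeft ρ) (D'.whiskerLeft ρ') := by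
  obtain ⟨Z, W, h⟩ := h
  refine ⟨(Z.whiskerLeft ρ).append (Y.whiskerRight φ'),
    (W.whiskerLeft ρ).append (Y.whiskerRight ψ'), ?_⟩
  simp only [Zigzag.diagram_append, Zigzag.diagram_whiskerLeft, Zigzag.diagram_whiskerRight]
  rw [← Diagram.vconcat_assoc, ← Diagram.whiskerLeft_vconcat,
    vconcat_congr_right (whiskerLeft_congr ρ h), Diagram.whiskerLeft_vconcat,
    Diagram.vconcat_assoc, Diagram.vconcat_assoc]
  exact vconcat_congr_left _ (interchange _ _).symm

theorem whiskerRight {x y z : C} {φ ψ φ' ψ' : Path x y} {D : Diagram φ ψ}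
    {D' : Diagram φ' ψ'} (h : ZigzagRel D D') {ρ ρ' : Path y z} (Y : Zigzag ρ ρ') :
    ZigzagRel (D.whiskerRight ρ) (D'.whiskerRight ρ') := by
  obtain ⟨Z, W, h⟩ := h
  refine ⟨(Z.whiskerRight ρ).append (Y.whiskerLeft φ'),
    (W.whiskerRight ρ).append (Y.whiskerLeft ψ'), ?_⟩
  simp only [Zigzag.diagram_append, Zigzag.diagram_whiskerLeft, Zigzag.diagram_whiskerRight]
  rw [← Diagram.vconcat_assoc, ← Diagram.whiskerRight_vconcat,
    vconcat_congr_right (whiskerRight_congr h ρ), Diagram.whiskerRight_vconcat,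
    Diagram.vconcat_assoc, Diagram.vconcat_assoc]
  exact vconcat_congr_left _ (interchange _ _)

theorem of_cong {x y : C} {φ ψ φ' ψ' : Path x y} {D : Diagram φ ψ} {D' : Diagram φ' ψ'}
    (h : Cong (fun _ => ∅) D D') : ZigzagRel D D' := by
  induction h with
  | move h => exact ⟨.nil _, .nil _, by
    rw [Zigzag.diagram, Diagram.vconcat_nil]
    exact Quot.sound h⟩
  -- The target is led back to the source by decomposing again; composing and then decomposing is a
  -- loop.
  | ident_src c => exact ⟨.nil _, .decomp c (.nil _), zigzag_loop (.comp c (.decomp c (.nil _)))⟩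
  | ident_tgt c => exact ⟨.comp c (.nil _), .nil _, rfl⟩
  | adj_src c => exact ⟨.nil _, .comp c (.nil _), zigzag_loop (.decomp c (.comp c (.nil _)))⟩
  | adj_tgt c => exact ⟨.decomp c (.nil _), .nil _, rfl⟩
  | unit e he => exact he.elim
  | refl D => exact ⟨.nil _, .nil _, by simp [Zigzag.diagram, Diagram.vconcat]⟩
  | symm _ ih => exact ih.symm
  | trans _ _ ih ih' => exact ih.trans ih'
  | vconcat _ _ ih ih' => exact ih.vconcat ih'
  | hconcat _ _ ih ih' =>
    -- Horizontal concatenation whiskers the first diagram by the source of the second, and the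
    -- second by the target of the first; hence the zigzags needed are the source one `Z'` and the
    -- target one `W`.
    obtain ⟨Z, W, h⟩ := id ih
    obtain ⟨Z', W', h'⟩ := id ih'
    exact (ih.whiskerRight Z').vconcat (ih'.whiskerLeft W)

end ZigzagRel

end DiagramAxiom

end PartialTwoPrecategory

namespace PartialTwoPrecategory

section Completion

/-! ### Diagrams up to congruence -/

variable {C : Type u} [PartialTwoPrecategory.{u, v, w} C] {E : ∀ x : C, Set (x ⟶ x)}

theorem Hom1.mk_concat_left {x y z : C} (ρ : Path x y) {φ ψ : Path y z} (h : OneStep E φ ψ) :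
    Hom1.mk E (ρ ♯ φ) = Hom1.mk E (ρ ♯ ψ) := by
  cases h with
  | comp c => exact Quot.sound (.comp (c.whiskerLeft ρ))
  | unit σ τ e he =>
    rw [← Path.comp_assoc, ← Path.comp_assoc, ← Path.comp_assoc]
    exact Quot.sound (.unit _ τ e he)

theorem Hom1.mk_concat_right {x y z : C} {φ ψ : Path x y} (h : OneStep E φ ψ) (ρ : Path y z) :
    Hom1.mk E (φ ♯ ρ) = Hom1.mk E (ψ ♯ ρ) := by
  cases h with
  | comp c => exact Quot.sound (.comp (c.whiskerRight ρ))
  | unit σ τ e he =>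
    rw [Path.comp_assoc, Path.comp_assoc σ τ]
    exact Quot.sound (.unit σ _ e he)

/-- Concatenation of classes of sequences. -/
def Hom1.concat {x y z : C} : Hom1 E x y → Hom1 E y z → Hom1 E x z :=
  Quot.lift₂ (fun φ ψ => Hom1.mk E (φ ♯ ψ)) (fun φ _ _ h => Hom1.mk_concat_left φ h)
    (fun _ _ ψ h => Hom1.mk_concat_right h ψ)

theorem Hom1.mk_comp {x y z : C} (φ : Path x y) (ψ : Path y z) :
    Hom1.mk E (φ ♯ ψ) = (Hom1.mk E φ).concat (Hom1.mk E ψ) :=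
  rfl

theorem Hom1.nil_concat {x y : C} (c : Hom1 E x y) : (Hom1.mk E Path.nil).concat c = c := by
  obtain ⟨φ⟩ := c
  exact congrArg (Hom1.mk E) (Path.nil_comp φ)

theorem Hom1.concat_nil {x y : C} (c : Hom1 E x y) : c.concat (Hom1.mk E Path.nil) = c := by
  obtain ⟨φ⟩ := c
  rfl

theorem Hom1.concat_assoc {x y z t : C} (c : Hom1 E x y) (d : Hom1 E y z) (e : Hom1 E z t) :
    (c.concat d).concat e = c.concat (d.concat e) := by
  obtain ⟨φ⟩ := c
  obtain ⟨ψ⟩ := d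
  obtain ⟨χ⟩ := e
  exact congrArg (Hom1.mk E) (Path.comp_assoc φ ψ χ)

namespace Cong

theorem of_heq {x y : C} {φ ψ φ' ψ' : Path x y} {D : Diagram φ ψ} {D' : Diagram φ' ψ'}
    (hφ : φ = φ') (hψ : ψ = ψ') (h : D ≍ D') : Cong E D D' := by
  subst hφ hψ h
  exact refl D

theorem of_mk_eq {x y : C} {φ ψ : Path x y} {D D' : Diagram φ ψ}
    (h : Hom2Rep.mk D = Hom2Rep.mk D') : Cong E D D' := by
  have h' := Quot.eqvGen_exact h
  clear h
  induction h' with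
  | rel _ _ h => exact .move h
  | refl D => exact .refl D
  | symm _ _ _ ih => exact ih.symm
  | trans _ _ _ _ _ ih ih' => exact ih.trans ih'

theorem whiskerLeft {x y z : C} {ρ ρ' : Path x y} (hρ : Cong E (.nil ρ) (.nil ρ'))
    {φ ψ φ' ψ' : Path y z} {D : Diagram φ ψ} {D' : Diagram φ' ψ'} (h : Cong E D D') :
    Cong E (D.whiskerLeft ρ) (D'.whiskerLeft ρ') :=
  hconcat hρ h

theorem whiskerRight {x y z : C} {φ ψ φ' ψ' : Path x y} {D : Diagram φ ψ}
    {D' : Diagram φ' ψ'} (h : Cong E D D') {ρ ρ' : Path y z}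
    (hρ : Cong E (.nil ρ) (.nil ρ')) :
    Cong E (D.whiskerRight ρ) (D'.whiskerRight ρ') := by
  simpa only [Diagram.hconcat, Diagram.whiskerLeft, Diagram.vconcat_nil] using hconcat h hρ

theorem nil_of_oneStep {x y : C} {φ ψ : Path x y} (h : OneStep E φ ψ) :
    Cong E (.nil φ) (.nil ψ) := by
  cases h with
  | comp c => exact (ident_src c).symm.trans (ident_tgt c)
  | unit σ τ e he => exact (whiskerLeft (refl (.nil σ)) (unit e he)).whiskerRight (refl (.nil τ))

theorem nil_of_mk_eq {x y : C} {φ ψ : Path x y} (h : Hom1.mk E φ = Hom1.mk E ψ) :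
    Cong E (.nil φ) (.nil ψ) := by
  have h' := Quot.eqvGen_exact h
  clear h
  induction h' with
  | rel _ _ h => exact nil_of_oneStep h
  | refl D => exact .refl _
  | symm _ _ _ ih => exact ih.symm
  | trans _ _ _ _ _ ih ih' => exact ih.trans ih'

/-- Every face of a zigzag collapses to its target. With `zigzag_src`, this makes it harmless to
attach a zigzag at either end of a diagram. -/
theorem zigzag_tgt {x y : C} {φ ψ : Path x y} (Z : Zigzag φ ψ) :
    Cong E Z.diagram (.nil ψ) := by
  induction Z with
  | nil => exact refl _
  | @comp φ χ ψ c Z ih => exact ((ident_tgt c).vconcat (refl Z.diagram)).trans ih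
  | @decomp φ χ ψ c Z ih => exact ((adj_tgt c).vconcat (refl Z.diagram)).trans ih

theorem zigzag_src {x y : C} {φ ψ : Path x y} (Z : Zigzag φ ψ) :
    Cong E Z.diagram (.nil φ) := by
  induction Z with
  | nil => exact refl _
  | comp c Z ih => exact ((refl (.single c.slice)).vconcat ih).trans (by
      rw [Diagram.vconcat_nil]
      exact ident_src c)
  | decomp c Z ih => exact ((refl (.single c.sliceAdj)).vconcat ih).trans (by
      rw [Diagram.vconcat_nil]
      exact adj_src c)

theorem zigzag_vconcat {x y : C} {φ χ ψ : Path x y} (Z : Zigzag φ χ) (D : Diagram χ ψ) :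
    Cong E (Z.diagram.vconcat D) D :=
  (zigzag_tgt Z).vconcat (refl D)

theorem vconcat_zigzag {x y : C} {φ χ ψ : Path x y} (D : Diagram φ χ) (Z : Zigzag χ ψ) :
    Cong E (D.vconcat Z.diagram) D := by
  simpa using (refl D).vconcat (zigzag_src (E := E) Z)

end Cong

/-! ### Absorbing identities -/

variable (E) in
open Classical in
/-- The sequence consisting of an element of `E` at `y`, if there is one, and the empty sequence
otherwise. -/
noncomputable def unitPath (y : C) : Path y y :=
  if h : (E y).Nonempty then h.some.toPath else Path.nil

@[simp]
theorem unitPath_empty (y : C) : unitPath (fun _ => ∅) y = Path.nil := by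
  simp [unitPath]

theorem Cong.unitPath (y : C) : Cong E (.nil (unitPath E y)) (.nil Path.nil) := by
  by_cases h : (E y).Nonempty
  · rw [PartialTwoPrecategory.unitPath, dif_pos h]
    exact .unit _ h.some_mem
  · rw [PartialTwoPrecategory.unitPath, dif_neg h]
    exact .refl _

theorem Hom1.mk_concat_unitPath {x y : C} (φ : Path x y) :
    Hom1.mk E (φ ♯ unitPath E y) = Hom1.mk E φ := by
  unfold PartialTwoPrecategory.unitPath
  split_ifs with h
  · exact Quot.sound (.unit φ Path.nil _ h.some_mem)
  · rfl

theorem Cong.concat_unitPath {x y : C} {φ ψ : Path x y} (D : Diagram φ ψ) :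
    Cong E (D.whiskerRight (PartialTwoPrecategory.unitPath E y)) D := by
  have h := (refl D).whiskerRight (Cong.unitPath (E := E) y)
  rwa [Diagram.whiskerRight_nil_path] at h

/-- Paths grow at their end, whereas an identity is absorbed by the first edge after it. -/
theorem exists_toPath_comp_eq_cons {x y : C} (p : Path x y) :
    ∀ {z : C} (g : y ⟶ z), ∃ (b : C) (f : x ⟶ b) (q : Path b z), p.cons g = f.toPath ♯ q := by
  induction p with
  | nil => exact fun g => ⟨_, g, Path.nil, rfl⟩
  | cons p h ih =>
    intro z g
    obtain ⟨b, f, q, hq⟩ := ih h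
    exact ⟨b, f, q.cons g, congrArg (Path.cons · g) hq⟩

/-- If `p` is empty then `y = x`, and the appended element of `E x` is the required first edge. -/
theorem exists_toPath_comp_eq_comp_unitPath {x y : C} (p : Path x y) (h : (E x).Nonempty) :
    ∃ (b : C) (f : x ⟶ b) (q : Path b y), p ♯ unitPath E y = f.toPath ♯ q := by
  cases p with
  | nil => exact ⟨x, h.some, Path.nil, by simp [unitPath, h]; rfl⟩
  | cons p g =>
    obtain ⟨b, f, q, hq⟩ := exists_toPath_comp_eq_cons p g
    exact ⟨b, f, q ♯ unitPath E y, by rw [hq, Path.comp_assoc]⟩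

/-- After `unitPath` has been appended, some edge `f` follows the deleted `e`, and `e ∘ f = f` turns
the deletion into a composition. -/
theorem OneStep.zigzag (hE : ∀ x, ∀ e ∈ E x, IsIdentity₁ e) {x y : C} {φ ψ : Path x y}
    (h : OneStep E φ ψ) : Nonempty (Zigzag (φ ♯ unitPath E y) (ψ ♯ unitPath E y)) := by
  cases h with
  | comp c => exact ⟨.comp (c.whiskerRight _) (.nil _)⟩
  | unit σ τ e he =>
    obtain ⟨b, f, q, hq⟩ := exists_toPath_comp_eq_comp_unitPath τ ⟨e, he⟩
    obtain ⟨hc, hf⟩ := (hE _ e he).1 b f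
    refine ⟨.comp ⟨σ, e, f, q, hc, ?_, ?_⟩ (.nil _)⟩
    · rw [Path.comp_assoc, hq]
      simp only [Path.comp_assoc]
    · rw [hf, Path.comp_assoc, hq, Path.comp_assoc]

theorem Hom1.zigzag_of_mk_eq (hE : ∀ x, ∀ e ∈ E x, IsIdentity₁ e) {x y : C} {φ ψ : Path x y}
    (h : Hom1.mk E φ = Hom1.mk E ψ) :
    Nonempty (Zigzag (φ ♯ unitPath E y) (ψ ♯ unitPath E y)) := by
  have h' := Quot.eqvGen_exact h
  clear h
  induction h' with
  | rel _ _ h => exact h.zigzag hE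
  | refl D => exact ⟨.nil _⟩
  | symm _ _ _ ih => exact ih.map Zigzag.reverse
  | trans _ _ _ _ _ ih ih' => exact ih.map2 Zigzag.append ih'

/-! ### Representatives of 2-morphisms -/

namespace Hom2

/-- `Cong` is already an equivalence relation, so the quotient identifies nothing further. -/
theorem mk_eq_mk_iff {x y : C} {c d : Hom1 E x y} (D D' : DiagramOver E c d) :
    (Quot.mk _ D : Hom2 E c d) = Quot.mk _ D' ↔ Cong E D.diagram D'.diagram := by
  refine ⟨fun h => ?_, fun h => Quot.sound h⟩
  have h' := Quot.eqvGen_exact h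
  clear h
  induction h' with
  | rel _ _ h => exact h
  | refl D => exact .refl _
  | symm _ _ _ ih => exact ih.symm
  | trans _ _ _ _ _ ih ih' => exact ih.trans ih'

/-- The diagram `D`, possibly between other representatives, represents the 2-morphism `f` up to
congruence. -/
def Rep {x y : C} {c d : Hom1 E x y} (f : Hom2 E c d) {φ ψ : Path x y} (D : Diagram φ ψ) : Prop :=
  ∃ D₀ : DiagramOver E c d, Quot.mk _ D₀ = f ∧ Cong E D₀.diagram D

namespace Rep

theorem cong {x y : C} {c d : Hom1 E x y} {f : Hom2 E c d} {φ ψ φ' ψ' : Path x y}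
    {D : Diagram φ ψ} {D' : Diagram φ' ψ'} (h : Rep f D) (h' : Rep f D') : Cong E D D' := by
  obtain ⟨D₀, rfl, h⟩ := h
  obtain ⟨D₁, h₁, h'⟩ := h'
  exact (h.symm.trans ((mk_eq_mk_iff _ _).1 h₁.symm)).trans h'

theorem congr {x y : C} {c d : Hom1 E x y} {f : Hom2 E c d} {φ ψ φ' ψ' : Path x y}
    {D : Diagram φ ψ} {D' : Diagram φ' ψ'} (h : Rep f D) (h' : Cong E D D') : Rep f D' := by
  obtain ⟨D₀, h₀, h⟩ := h
  exact ⟨D₀, h₀, h.trans h'⟩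

/-- The tool for all 2-category axioms: represent both sides by convenient diagrams and compare
these, whatever their boundary sequences. -/
theorem eq {x y : C} {c d : Hom1 E x y} {f g : Hom2 E c d} {φ ψ φ' ψ' : Path x y}
    {D : Diagram φ ψ} {D' : Diagram φ' ψ'} (hf : Rep f D) (hg : Rep g D') (h : Cong E D D') :
    f = g := by
  obtain ⟨D₀, rfl, h₀⟩ := hf
  obtain ⟨D₁, rfl, h₁⟩ := hg
  exact (mk_eq_mk_iff _ _).2 ((h₀.trans h).trans h₁.symm)

theorem mk {x y : C} {φ ψ : Path x y} (D : Diagram φ ψ) : Rep (Hom2.mk E D) D :=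
  ⟨_, rfl, .refl _⟩

end Rep

/-- A representative of a class of sequences that ends with an element of `E` if possible. -/
noncomputable def _root_.PartialTwoPrecategory.Hom1.out {x y : C} (c : Hom1 E x y) : Path x y :=
  Quot.out c ♯ unitPath E y

theorem _root_.PartialTwoPrecategory.Hom1.mk_out {x y : C} (c : Hom1 E x y) :
    Hom1.mk E c.out = c :=
  (Hom1.mk_concat_unitPath _).trans (Quot.out_eq c)

theorem exists_rep (hE : ∀ x, ∀ e ∈ E x, IsIdentity₁ e) {x y : C} {c d : Hom1 E x y}
    {φ ψ : Path x y} (hφ : Hom1.mk E φ = c) (hψ : Hom1.mk E ψ = d) (f : Hom2 E c d) :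
    ∃ D : Diagram (φ ♯ unitPath E y) (ψ ♯ unitPath E y), Rep f D := by
  obtain ⟨⟨D, h₁, h₂⟩⟩ := f
  obtain ⟨Z⟩ := Hom1.zigzag_of_mk_eq hE (hφ.trans h₁.symm)
  obtain ⟨W⟩ := Hom1.zigzag_of_mk_eq hE (h₂.trans hψ.symm)
  -- Neither the whiskering by `unitPath` nor the zigzags at both ends change the class of `D`.
  exact ⟨Z.diagram.vconcat ((D.whiskerRight _).vconcat W.diagram), ⟨D, h₁, h₂⟩, rfl,
    (((Cong.zigzag_vconcat Z _).trans (Cong.vconcat_zigzag _ W)).trans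
      (Cong.concat_unitPath D)).symm⟩

/-! ### Compositions of 2-morphisms. -/

variable (hE : ∀ x, ∀ e ∈ E x, IsIdentity₁ e)

/-- A diagram between the chosen representatives of source and target. -/
noncomputable def out {x y : C} {c d : Hom1 E x y} (f : Hom2 E c d) : Diagram c.out d.out :=
  (exists_rep hE (Quot.out_eq c) (Quot.out_eq d) f).choose

theorem rep_out {x y : C} {c d : Hom1 E x y} (f : Hom2 E c d) : Rep f (f.out hE) :=
  (exists_rep hE (Quot.out_eq c) (Quot.out_eq d) f).choose_spec

/-- The identity 2-morphism. -/
noncomputable def id {x y : C} (c : Hom1 E x y) : Hom2 E c c :=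
  Quot.mk _ ⟨.nil c.out, c.mk_out, c.mk_out⟩

/-- Vertical composition. -/
noncomputable def comp {x y : C} {c d e : Hom1 E x y} (f : Hom2 E c d) (g : Hom2 E d e) :
    Hom2 E c e :=
  -- The chosen diagrams meet in the same sequence `d.out`, so they can be concatenated.
  Quot.mk _ ⟨(f.out hE).vconcat (g.out hE), c.mk_out, e.mk_out⟩

theorem _root_.PartialTwoPrecategory.Hom1.mk_out_concat_out {x y z : C} (c : Hom1 E x y)
    (d : Hom1 E y z) : Hom1.mk E (c.out ♯ d.out) = c.concat d :=
  congrArg₂ Hom1.concat c.mk_out d.mk_out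

/-- Horizontal composition with an identity on the left. -/
noncomputable def whiskerLeft {x y z : C} (c : Hom1 E x y) {d e : Hom1 E y z} (f : Hom2 E d e) :
    Hom2 E (c.concat d) (c.concat e) :=
  Quot.mk _ ⟨(f.out hE).whiskerLeft c.out, c.mk_out_concat_out d, c.mk_out_concat_out e⟩

/-- Horizontal composition with an identity on the right. -/
noncomputable def whiskerRight {x y z : C} {c d : Hom1 E x y} (f : Hom2 E c d) (e : Hom1 E y z) :
    Hom2 E (c.concat e) (d.concat e) :=
  Quot.mk _ ⟨(f.out hE).whiskerRight e.out, c.mk_out_concat_out e, d.mk_out_concat_out e⟩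

namespace Rep

theorem id {x y : C} {c : Hom1 E x y} {φ : Path x y} (h : Hom1.mk E φ = c) :
    Rep (Hom2.id c) (.nil φ) :=
  ⟨_, rfl, Cong.nil_of_mk_eq (c.mk_out.trans h.symm)⟩

variable {hE}

/-- Any adjacent representatives compute the composite: the chosen ones are congruent to them, and
`Cong` respects concatenation. -/
theorem comp {x y : C} {c d e : Hom1 E x y} {f : Hom2 E c d} {g : Hom2 E d e}
    {φ χ ψ : Path x y} {D : Diagram φ χ} {F : Diagram χ ψ} (hf : Rep f D) (hg : Rep g F) :
    Rep (f.comp hE g) (D.vconcat F) :=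
  ⟨_, rfl, ((f.rep_out hE).cong hf).vconcat ((g.rep_out hE).cong hg)⟩

theorem whiskerLeft {x y z : C} {c : Hom1 E x y} {d e : Hom1 E y z} {f : Hom2 E d e}
    {ρ : Path x y} {φ ψ : Path y z} {D : Diagram φ ψ} (hρ : Hom1.mk E ρ = c) (hf : Rep f D) :
    Rep (f.whiskerLeft hE c) (D.whiskerLeft ρ) :=
  ⟨_, rfl, .whiskerLeft (Cong.nil_of_mk_eq (c.mk_out.trans hρ.symm))
    ((f.rep_out hE).cong hf)⟩

theorem whiskerRight {x y z : C} {c d : Hom1 E x y} {e : Hom1 E y z} {f : Hom2 E c d}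
    {ρ : Path y z} {φ ψ : Path x y} {D : Diagram φ ψ} (hf : Rep f D) (hρ : Hom1.mk E ρ = e) :
    Rep (f.whiskerRight hE e) (D.whiskerRight ρ) :=
  ⟨_, rfl, ((f.rep_out hE).cong hf).whiskerRight
    (Cong.nil_of_mk_eq (e.mk_out.trans hρ.symm))⟩

end Rep

/-- The category of 1-morphisms with given ends, with vertical composition. -/
@[reducible]
noncomputable def category (x y : C) : Category.{max u v w} (Hom1 E x y) where
  Hom := Hom2 E
  id := Hom2.id
  comp f g := f.comp hE g
  id_comp {c _} f := (Rep.comp (.id c.mk_out) (f.rep_out hE)).eq (f.rep_out hE) (.refl _)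
  comp_id {_ d} f := (Rep.comp (f.rep_out hE) (.id d.mk_out)).eq (f.rep_out hE) (by
    rw [Diagram.vconcat_nil]
    exact .refl _)
  assoc f g h := ((Rep.comp (f.rep_out hE) (g.rep_out hE)).comp (h.rep_out hE)).eq
    (Rep.comp (f.rep_out hE) ((g.rep_out hE).comp (h.rep_out hE))) (by
      rw [Diagram.vconcat_assoc]
      exact .refl _)

/-- The coherence isomorphisms are transports along equalities of classes. Represented by diagrams
without faces, they drop out of every comparison. -/
theorem rep_eqToHom {x y : C} {c d : Hom1 E x y} (h : c = d) {φ : Path x y}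
    (hφ : Hom1.mk E φ = c) :
    letI := category hE x y
    Rep (E := E) (eqToHom h) (.nil φ) := by
  subst h
  exact .id hφ

end Hom2

end Completion

end PartialTwoPrecategory

namespace PartialTwoPrecategory

/-! ### Bijectivity for fixed representatives, and the strict 2-category. -/

section TwoCategory

open Hom2

variable {C : Type u} [PartialTwoCategory.{u, v, w} C] {E : ∀ x : C, Set (x ⟶ x)}

theorem Hom2.bijective_ofRep {x y : C} (φ ψ : Path x y) :
    Function.Bijective (Hom2.ofRep (fun _ => ∅) φ ψ) := by
  constructor
  · rintro ⟨D⟩ ⟨D'⟩ h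
    -- Both diagrams run from `φ` to `ψ`, so `Z` and `W` are loops and can be removed.
    obtain ⟨Z, W, h⟩ := ZigzagRel.of_cong ((Hom2.mk_eq_mk_iff _ _).1 h)
    have hW := Hom2Rep.vconcat_congr_left D (Hom2Rep.zigzag_loop W)
    have hZ := Hom2Rep.vconcat_congr_right (Hom2Rep.zigzag_loop Z) D'
    rw [Diagram.vconcat_nil] at hW
    exact (hW.symm.trans h).trans hZ
  · intro f
    have h := Hom2.exists_rep (fun _ _ he => he.elim) rfl rfl f
    -- For empty `E` nothing is appended, so the representative found runs between `φ` and `ψ`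
    -- themselves.
    rw [unitPath_empty] at h
    obtain ⟨D, hD⟩ := h
    exact ⟨Hom2Rep.mk D, (Hom2.Rep.mk D).eq hD (.refl _)⟩

variable (hE : ∀ x, ∀ e ∈ E x, IsIdentity₁ e)

/-- The completion as a bicategory. -/
@[reducible]
noncomputable def completionBicategory :
    Bicategory.{max u v w, max u v} (Completion C) where
  Hom X Y := Hom1 E X.obj Y.obj
  id X := Hom1.mk E Path.nil
  comp c d := Hom1.concat c d
  homCategory X Y := Hom2.category hE X.obj Y.obj
  whiskerLeft c _ _ f := f.whiskerLeft hE c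
  whiskerRight f c := f.whiskerRight hE c
  associator c d e :=
    letI := Hom2.category hE
    eqToIso (Hom1.concat_assoc c d e)
  leftUnitor {X Y} c :=
    letI := Hom2.category hE X.obj Y.obj
    eqToIso (Hom1.nil_concat c)
  rightUnitor {X Y} c :=
    letI := Hom2.category hE X.obj Y.obj
    eqToIso (Hom1.concat_nil c)
  whiskerLeft_id c d :=
    (Rep.whiskerLeft c.mk_out (.id d.mk_out)).eq (.id (c.mk_out_concat_out d)) (.refl _)
  whiskerLeft_comp c _ _ _ f g :=
    (Rep.whiskerLeft c.mk_out (.comp (f.rep_out hE) (g.rep_out hE))).eq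
      (.comp (.whiskerLeft c.mk_out (f.rep_out hE)) (.whiskerLeft c.mk_out (g.rep_out hE)))
      (by
        rw [Diagram.whiskerLeft_vconcat]
        exact .refl _)
  id_whiskerLeft {_ _ c d} f :=
    (Rep.whiskerLeft rfl (f.rep_out hE)).eq
      (.comp (rep_eqToHom hE (Hom1.nil_concat c) (c.mk_out.trans c.nil_concat.symm))
        (.comp (f.rep_out hE) (rep_eqToHom hE (Hom1.nil_concat d).symm d.mk_out)))
      (by
        rw [Diagram.vconcat_nil]
        exact .of_heq (Path.nil_comp _) (Path.nil_comp _) (Diagram.whiskerLeft_nil_path _))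
  comp_whiskerLeft c c' d e f :=
    (Rep.whiskerLeft (c.mk_out_concat_out c') (f.rep_out hE)).eq
      (.comp (rep_eqToHom hE (Hom1.concat_assoc c c' d)
          (by simp only [Hom1.mk_comp, Hom1.mk_out, Hom1.concat_assoc]))
        (.comp (.whiskerLeft c.mk_out (.whiskerLeft c'.mk_out (f.rep_out hE)))
          (rep_eqToHom hE (Hom1.concat_assoc c c' e).symm
            (by simp only [Hom1.mk_comp, Hom1.mk_out]))))
      (by
        rw [Diagram.vconcat_nil]
        exact .symm (.of_heq (Path.comp_assoc _ _ _).symm (Path.comp_assoc _ _ _).symm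
          (Diagram.whiskerLeft_whiskerLeft _ _ _)))
  id_whiskerRight c d :=
    (Rep.whiskerRight (.id c.mk_out) d.mk_out).eq (.id (c.mk_out_concat_out d)) (.refl _)
  comp_whiskerRight f g c :=
    (Rep.whiskerRight (.comp (f.rep_out hE) (g.rep_out hE)) c.mk_out).eq
      (.comp (.whiskerRight (f.rep_out hE) c.mk_out) (.whiskerRight (g.rep_out hE) c.mk_out))
      (by
        rw [Diagram.whiskerRight_vconcat]
        exact .refl _)
  whiskerRight_id {_ _ c d} f :=
    (Rep.whiskerRight (f.rep_out hE) rfl).eq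
      (.comp (rep_eqToHom hE (Hom1.concat_nil c) (c.mk_out.trans c.concat_nil.symm))
        (.comp (f.rep_out hE) (rep_eqToHom hE (Hom1.concat_nil d).symm d.mk_out)))
      (by
        rw [Diagram.vconcat_nil, Diagram.whiskerRight_nil_path]
        exact .refl _)
  whiskerRight_comp {_ _ _ _ d e} f c c' :=
    (Rep.whiskerRight (f.rep_out hE) (c.mk_out_concat_out c')).eq
      (.comp (rep_eqToHom hE (Hom1.concat_assoc d c c').symm
          (by simp only [Hom1.mk_comp, Hom1.mk_out, Hom1.concat_assoc]))
        (.comp (.whiskerRight (.whiskerRight (f.rep_out hE) c.mk_out) c'.mk_out)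
          (rep_eqToHom hE (Hom1.concat_assoc e c c')
            (by simp only [Hom1.mk_comp, Hom1.mk_out]))))
      (by
        rw [Diagram.vconcat_nil]
        exact .symm (.of_heq (Path.comp_assoc _ _ _) (Path.comp_assoc _ _ _)
          (Diagram.whiskerRight_whiskerRight _ _ _)))
  whisker_assoc c d e f c' :=
    (Rep.whiskerRight (.whiskerLeft c.mk_out (f.rep_out hE)) c'.mk_out).eq
      (.comp (rep_eqToHom hE (Hom1.concat_assoc c d c')
          (by simp only [Hom1.mk_comp, Hom1.mk_out, Hom1.concat_assoc]))
        (.comp (.whiskerLeft c.mk_out (.whiskerRight (f.rep_out hE) c'.mk_out))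
          (rep_eqToHom hE (Hom1.concat_assoc c e c').symm
            (by simp only [Hom1.mk_comp, Hom1.mk_out]))))
      (by
        rw [Diagram.vconcat_nil]
        exact .of_heq (Path.comp_assoc _ _ _) (Path.comp_assoc _ _ _)
          (Diagram.whiskerLeft_whiskerRight _ _ _))
  whisker_exchange {_ _ _ c d c' d'} f g :=
    (Rep.comp (.whiskerLeft c.mk_out (g.rep_out hE))
        (.whiskerRight (f.rep_out hE) d'.mk_out)).eq
      (.comp (.whiskerRight (f.rep_out hE) c'.mk_out)
        (.whiskerLeft d.mk_out (g.rep_out hE)))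
      -- The one axiom that rests on moves of faces and not only on rebracketing.
      (.of_mk_eq (Hom2Rep.interchange _ _).symm)
  pentagon c d e f := by
    have hp : Hom1.mk E (c.out ♯ d.out ♯ e.out ♯ f.out) =
        ((c.concat d).concat e).concat f := by
      simp only [Hom1.mk_comp, Hom1.mk_out]
    have hq : Hom1.mk E (c.out ♯ d.out ♯ e.out) = (c.concat d).concat e := by
      simp only [Hom1.mk_comp, Hom1.mk_out]
    have hr : Hom1.mk E (d.out ♯ e.out ♯ f.out) = (d.concat e).concat f := by
      simp only [Hom1.mk_comp, Hom1.mk_out]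
    exact (Rep.comp (.whiskerRight (rep_eqToHom hE (Hom1.concat_assoc c d e) hq) f.mk_out)
      (.comp
        (rep_eqToHom hE (Hom1.concat_assoc c (d.concat e) f) (hp.trans (by
          simp only [Hom1.concat_assoc])))
        -- The whiskered transport lives on another bracketing; a congruence moves it to the common
        -- sequence, where it can be concatenated with the others.
        ((Rep.whiskerLeft c.mk_out
          (rep_eqToHom hE (Hom1.concat_assoc d e f) hr)).congr
            (Cong.nil_of_mk_eq (by simp only [Hom1.mk_comp, Hom1.concat_assoc]))))).eq
      (Rep.comp (rep_eqToHom hE (Hom1.concat_assoc (c.concat d) e f) hp)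
        (rep_eqToHom hE (Hom1.concat_assoc c d (e.concat f))
          (hp.trans (Hom1.concat_assoc _ _ _))))
      (.refl _)
  triangle c d :=
    (Rep.comp
      (rep_eqToHom hE (Hom1.concat_assoc c (Hom1.mk E Path.nil) d) (φ := c.out ♯ d.out) (by
        simp only [Hom1.mk_comp, Hom1.mk_out, Hom1.concat_nil]))
      ((Rep.whiskerLeft c.mk_out (rep_eqToHom hE (Hom1.nil_concat d)
        (φ := Path.nil ♯ d.out) (by simp only [Hom1.mk_comp, Hom1.mk_out]))).congr
          (Cong.nil_of_mk_eq (by rw [Path.nil_comp])))).eq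
      (.whiskerRight (rep_eqToHom hE (Hom1.concat_nil c) (φ := c.out) (by
        simp only [Hom1.mk_out, Hom1.concat_nil])) d.mk_out)
      (.refl _)

/-- The completion as a strict 2-category. -/
noncomputable def completionTwoCategory : CompletionTwoCategory C E where
  bicategory := completionBicategory hE
  strict :=
    letI := completionBicategory hE
    { id_comp := Hom1.nil_concat
      comp_id := Hom1.concat_nil
      assoc := Hom1.concat_assoc }
  hom₁ _ _ := Equiv.refl _
  hom₂ _ _ := Equiv.refl _
  hom₁_nil _ := rfl
  hom₁_concat _ _ := rfl
  hom₂_nil φ := (Rep.mk _).eq (.id rfl) (.refl _)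
  hom₂_vconcat D F := (Rep.mk _).eq (.comp (.mk D) (.mk F)) (.refl _)
  hom₂_hconcat {_ _ _ φ ψ φ' ψ'} D F :=
    (Rep.mk (D.hconcat F)).eq
      (.comp (rep_eqToHom hE (Hom1.mk_comp φ φ') (φ := φ ♯ φ') rfl)
        (.comp (.comp (.whiskerRight (.mk D) rfl) (.whiskerLeft rfl (.mk F)))
          (rep_eqToHom hE (Hom1.mk_comp ψ ψ').symm (φ := ψ ♯ ψ') rfl)))
      (by
        rw [Diagram.vconcat_nil]
        exact .refl _)

end TwoCategory

end PartialTwoPrecategory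

theorem mainTheorem4 (C : Type u) [PartialTwoCategory.{u, v, w} C] :
    -- the sets `hom²(φ, ψ)` for equivalent representatives are canonically identified
    (∀ {x y : C} (φ φ' ψ : Quiver.Path x y), Nonempty (Zigzag φ φ') →
      (∃ m : Hom2Rep φ' ψ ≃ Hom2Rep φ ψ,
        (∀ (Z : Zigzag φ φ') (A : Diagram φ' ψ),
          m (Hom2Rep.mk A) = Hom2Rep.mk (Z.diagram.vconcat A)) ∧
        ∀ (Z : Zigzag φ' φ) (A : Diagram φ ψ),
          m.symm (Hom2Rep.mk A) = Hom2Rep.mk (Z.diagram.vconcat A)) ∧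
      ∃ m : Hom2Rep ψ φ ≃ Hom2Rep ψ φ',
        (∀ (Z : Zigzag φ φ') (A : Diagram ψ φ),
          m (Hom2Rep.mk A) = Hom2Rep.mk (A.vconcat Z.diagram)) ∧
        ∀ (Z : Zigzag φ' φ) (A : Diagram ψ φ'),
          m.symm (Hom2Rep.mk A) = Hom2Rep.mk (A.vconcat Z.diagram)) ∧
    -- for sequences modulo composition, `hom²([φ], [ψ])` is `hom²(φ, ψ)`
    (∀ {x y : C} (φ ψ : Quiver.Path x y),
      Function.Bijective (Hom2.ofRep (fun _ => ∅) φ ψ)) ∧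
    -- the completion is a strict 2-category, whichever identities are identified with the
    -- empty sequences
    ∀ E : ∀ x : C, Set (x ⟶ x), (∀ (x : C), ∀ e ∈ E x, IsIdentity₁ e) →
      Nonempty (CompletionTwoCategory C E) := by
  refine ⟨fun φ φ' ψ ⟨Z⟩ => ⟨⟨Hom2Rep.zigzagEquivSrc Z ψ, fun W A => ?_, fun W A => ?_⟩,
    Hom2Rep.zigzagEquivTgt Z ψ, fun W A => ?_, fun W A => ?_⟩, Hom2.bijective_ofRep,
    fun E hE => ⟨completionTwoCategory hE⟩⟩
  -- The bijection is built from one zigzag `Z`; by uniqueness every other zigzag gives the same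
  -- map.
  · exact Hom2Rep.vconcat_congr_right (Hom2Rep.zigzag_unique Z W) A
  · exact Hom2Rep.vconcat_congr_right (Hom2Rep.zigzag_unique Z.reverse W) A
  · exact Hom2Rep.vconcat_congr_left A (Hom2Rep.zigzag_unique Z W)
  · exact Hom2Rep.vconcat_congr_left A (Hom2Rep.zigzag_unique Z.reverse W)
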